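/- **Setting.** Let $d\in\{2,3\}$ and let $\Omega\subset\mathbb R^d$ be open with $\Omega=\operatorname{int}\overline\Omega$ (e.g. a bounded polygonal/polyhedral Lipschitz domain). Let $\mathcal M$ be a matching simplicial mesh of $\Omega$: a finite set of closed nondegenerate $d$-simplices with union $\overline\Omega$ such that, for all $K,K'\in\mathcal M$, the set $K\cap K'$ is the convex hull of a (possibly empty) subset of the vertices of $K$. Let $\mathcal F_K$ be the set of the $(d-1)$-dimensional faces of $K$, let $\mathcal F=\bigcup_K\mathcal F_K$ be the set of faces, and let $\Sigma$ be their union; a face is an interface if it belongs to two distinct cells, and a boundary face otherwise. Let $n_K$ be the outer unit normal of $K$. $\mathbb P_n(K)$, $\mathbb P_n(F)$ are the polynomials of total degree $\le n$ on the cell $K$, the face $F$ ($\mathbb P_{-1}=\{0\}$). Let $\|\cdot\|$ be the $L^2(\Omega)$-norm and $\nabla_{\mathcal M}$ the cell-wise gradient. Fix $p\in\mathbb N_0$. Let $\hat H$ be the space of pairs $\hat s=(s_{\mathcal M},s_\Sigma)$ consisting of a family $s_{\mathcal M}=(s_K)_{K\in\mathcal M}$ with $s_K\in\mathbb P_p(K)$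 and a family $s_\Sigma=(s_F)_{F\in\mathcal F}$ with $s_F\in\mathbb P_p(F)$ and $s_F=0$ on boundary faces. The reconstruction $\mathcal R\hat s$ is the piecewise polynomial with $(\mathcal R\hat s)_{|K}\in\mathbb P_{p+1}(K)$ determined on each $K\in\mathcal M$ by $$\int_K\nabla\mathcal R\hat s\cdot\nabla q=-\int_K s_{\mathcal M}\,\Delta q+\int_{\partial K}s_\Sigma\,\nabla q\cdot n_K\quad\forall q\in\mathbb P_{p+1}(K),\qquad \int_K\mathcal R\hat s=\int_K s_{\mathcal M}.$$ Let $\Pi_K$ and $\Pi_F$ be the $L^2$-orthogonal projections onto $\mathbb P_p(K)$ and $\mathbb P_p(F)$, for every cell $K$ and every face $F$, let $(\mathcal S\hat s)_{|K}=s_K+(\mathrm{Id}-\Pi_K)(\mathcal R\hat s)_{|K}$, and, for given weights $w_F>0$ (for instance $w_F=(\operatorname{diam}F)^{-1}$, or $w_F=1$), let $$S(\hat s,\hat\sigma)=\sum_{K\in\mathcal M}\sum_{F\in\mathcal F_K}w_F\int_F\Pi_F\big(s_F-(\mathcal S\hat s)_{|K}\big)\,\Pi_F\big(\sigma_F-(\mathcal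 S\hat\sigma)_{|K}\big),\qquad b(\hat s,\hat\sigma)=\int_\Omega\nabla_{\mathcal M}\mathcal R\hat s\cdot\nabla_{\mathcal M}\mathcal R\hat\sigma+S(\hat s,\hat\sigma).$$ Let $\hat V=\{\hat v=(v,v_{|\Sigma}) : v\in H^1_0(\Omega)\}$, where $v_{|\Sigma}$ is the trace, and on $\hat V+\hat H$ consider the extended form and semi-norm $$\tilde a(\hat v+\hat s,\hat v'+\hat\sigma)=\int_\Omega\nabla_{\mathcal M}(v+\mathcal R\hat s)\cdot\nabla_{\mathcal M}(v'+\mathcal R\hat\sigma)+S(\hat s,\hat\sigma),\qquad |\hat v+\hat s|=\sqrt{\tilde a(\hat v+\hat s,\hat v+\hat s)}.$$ **Proposition (quasi-optimality).** Let $E_H:\hat H\to H^1_0(\Omega)$ be a linear operator which preserves moments: for all $\hat\sigma\in\hat H$, $$\int_K q\,E_H\hat\sigma=\int_K q\,\sigma_{\mathcal M}\quad\forall K\in\mathcal M,\ q\in\mathbb P_{p-1}(K),\qquad \int_F r\,E_H\hat\sigma=\int_F r\,\sigma_\Sigma\quad\text{for all interfaces }F,\ r\in\mathbb P_p(F).$$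 Then, for every $f\in H^{-1}(\Omega)$, there is exactly one $\hat U\in\hat H$ such that $b(\hat U,\hat\sigma)=\langle f,E_H\hat\sigma\rangle$ for all $\hat\sigma\in\hat H$ (the modified HHO solution). Moreover, there is a smallest constant $C_H\ge 0$ such that $$\|\nabla_{\mathcal M}(\mathcal R\hat\sigma-E_H\hat\sigma)\|\le C_H\,|\hat\sigma|\qquad\forall\hat\sigma\in\hat H,$$ and, for every $f\in H^{-1}(\Omega)$, if $u\in H^1_0(\Omega)$ solves $\int_\Omega\nabla u\cdot\nabla v=\langle f,v\rangle$ for all $v\in H^1_0(\Omega)$, and $\hat u=(u,u_{|\Sigma})$, then the modified HHO solution $\hat U$ satisfies $$|\hat u-\hat U|\le\sqrt{1+C_H^2}\;\inf_{\hat s\in\hat H}|\hat u-\hat s|.$$ -/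

import Mathlib

open MeasureTheory TopologicalSpace
open scoped InnerProductSpace Distributions

noncomputable section

namespace HHO

/-- The Euclidean space `ℝ^d`. -/
abbrev Space (d : ℕ) : Type := EuclideanSpace ℝ (Fin d)

/-! ### Polynomials on `ℝ^d` -/

/-- `ℙ_n`: real polynomials in `d` variables of total degree at most `n`. -/
abbrev Poly (d n : ℕ) : Submodule ℝ (MvPolynomial (Fin d) ℝ) :=
  MvPolynomial.restrictTotalDegree (Fin d) ℝ n

/-- The function on `ℝ^d` given by a polynomial. -/
def polyFun {d : ℕ} (q : MvPolynomial (Fin d) ℝ) (x : Space d) : ℝ :=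
  MvPolynomial.eval (fun i => x i) q

/-- The gradient of a polynomial, as a vector field on `ℝ^d`. -/
def polyGrad {d : ℕ} (q : MvPolynomial (Fin d) ℝ) (x : Space d) : Space d :=
  WithLp.toLp 2 fun i => polyFun (MvPolynomial.pderiv i q) x

/-- The Laplacian of a polynomial. -/
def polyLaplacian {d : ℕ} (q : MvPolynomial (Fin d) ℝ) : MvPolynomial (Fin d) ℝ :=
  ∑ i, MvPolynomial.pderiv i (MvPolynomial.pderiv i q)

/-! ### Matching simplicial meshes -/

/-- The closed convex hull of a finite set of points; a simplex is identified with its finite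
set of vertices. -/
abbrev hull {d : ℕ} (A : Finset (Space d)) : Set (Space d) := convexHull ℝ (A : Set (Space d))

/-- A matching simplicial mesh of the open set `Ω`: finitely many (closed, nondegenerate)
`d`-simplices, given by their vertex sets, which cover the closure of `Ω`, and such that the
intersection of two of them is the convex hull of a (possibly empty) subset of the vertices
of the first one (and so, by symmetry, of the second one). -/
structure SimplicialMesh (d : ℕ) (Ω : Opens (Space d)) where
  cells : Finset (Finset (Space d))
  card_eq : ∀ K ∈ cells, K.card = d + 1
  affineIndependent : ∀ K ∈ cells, AffineIndependent ℝ ((↑) : K → Space d)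
  inter_eq : ∀ K ∈ cells, ∀ K' ∈ cells, ∃ A ⊆ K, hull K ∩ hull K' = hull A
  iUnion_eq : ⋃ K ∈ cells, hull K = closure (Ω : Set (Space d))

variable {d : ℕ} {Ω : Opens (Space d)}

open scoped Classical in
/-- The faces of the mesh: the `(d-1)`-dimensional faces of its cells, given by their `d`
vertices. -/
def SimplicialMesh.faces (M : SimplicialMesh d Ω) : Finset (Finset (Space d)) :=
  M.cells.biUnion fun K => K.powersetCard d

open scoped Classical in
/-- The face of the cell `K` opposite to its vertex `a`. As `a` runs through the vertices of `K`,
this enumerates the faces of `K`. -/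
def SimplicialMesh.facet (M : SimplicialMesh d Ω) (K : M.cells) (a : K.1) : M.faces :=
  ⟨K.1.erase a.1, by
    refine Finset.mem_biUnion.2 ⟨K.1, K.2, Finset.mem_powersetCard.2 ⟨K.1.erase_subset _, ?_⟩⟩
    rw [Finset.card_erase_of_mem a.2, M.card_eq K.1 K.2, Nat.add_sub_cancel]⟩

/-- A face is an interface if it is a face of two distinct cells; the other faces are the
boundary faces. -/
def SimplicialMesh.IsInterface (M : SimplicialMesh d Ω) (F : M.faces) : Prop :=
  ∃ K₁ ∈ M.cells, ∃ K₂ ∈ M.cells, K₁ ≠ K₂ ∧ F.1 ⊆ K₁ ∧ F.1 ⊆ K₂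

/-- The component orthogonal to the face of `K` opposite to the vertex `a` of the vector from the
barycenter of this face to `a`. It is an inner normal vector. -/
def SimplicialMesh.altitude (M : SimplicialMesh d Ω) (K : M.cells) (a : K.1) : Space d :=
  (vectorSpan ℝ ((M.facet K a).1 : Set (Space d)))ᗮ.starProjection
    (a.1 - (M.facet K a).1.centroid ℝ id)

/-- The outer unit normal `n_K` of the cell `K` on the face opposite to the vertex `a`. -/
def SimplicialMesh.normal (M : SimplicialMesh d Ω) (K : M.cells) (a : K.1) : Space d :=
  (-‖M.altitude K a‖⁻¹) • M.altitude K a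

/-- The `(d-1)`-dimensional surface measure on the face `F`. -/
def SimplicialMesh.faceMeasure (M : SimplicialMesh d Ω) (F : M.faces) : Measure (Space d) :=
  (Measure.euclideanHausdorffMeasure (d - 1)).restrict (hull F.1)

/-! ### Basic facts, needed for the definitions below -/

theorem continuous_polyFun (q : MvPolynomial (Fin d) ℝ) : Continuous (polyFun q) := by
  unfold polyFun
  exact (MvPolynomial.continuous_eval q).comp (by fun_prop)

theorem continuous_polyGrad (q : MvPolynomial (Fin d) ℝ) : Continuous (polyGrad q) := by
  unfold polyGrad
  exact (PiLp.continuous_toLp 2 _).comp (continuous_pi fun i => continuous_polyFun _)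

theorem isCompact_hull (A : Finset (Space d)) : IsCompact (hull A) :=
  A.finite_toSet.isCompact_convexHull ℝ

theorem polyFun_add (q r : MvPolynomial (Fin d) ℝ) (x : Space d) :
    polyFun (q + r) x = polyFun q x + polyFun r x := by simp [polyFun]

theorem polyFun_smul (c : ℝ) (q : MvPolynomial (Fin d) ℝ) (x : Space d) :
    polyFun (c • q) x = c * polyFun q x := by simp [polyFun]

theorem polyGrad_add (q r : MvPolynomial (Fin d) ℝ) (x : Space d) :
    polyGrad (q + r) x = polyGrad q x + polyGrad r x := by
  ext i; simp [polyGrad, polyFun_add]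

theorem polyGrad_smul (c : ℝ) (q : MvPolynomial (Fin d) ℝ) (x : Space d) :
    polyGrad (c • q) x = c • polyGrad q x := by
  ext i; simp [polyGrad, polyFun_smul]

theorem polyLaplacian_add (q r : MvPolynomial (Fin d) ℝ) :
    polyLaplacian (q + r) = polyLaplacian q + polyLaplacian r := by
  simp [polyLaplacian, Finset.sum_add_distrib]

theorem polyLaplacian_smul (c : ℝ) (q : MvPolynomial (Fin d) ℝ) :
    polyLaplacian (c • q) = c • polyLaplacian q := by
  simp [polyLaplacian, Finset.smul_sum]

theorem hausdorffMeasure_hull_lt_top {n : ℕ} (A : Finset (Space d)) (hA : A.card = n + 1) :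
    (Measure.hausdorffMeasure (n : ℝ) : Measure (Space d)) (hull A) < ⊤ := by
  classical
  obtain ⟨a, ha⟩ : A.Nonempty := Finset.card_pos.1 (by omega)
  have hcard : Fintype.card (A.erase a) = n := by
    rw [Fintype.card_coe, Finset.card_erase_of_mem ha]; omega
  let L : (↥(A.erase a) → ℝ) →ₗ[ℝ] Space d :=
    ∑ b, (LinearMap.proj b : (↥(A.erase a) → ℝ) →ₗ[ℝ] ℝ).smulRight (b.1 - a)
  have hL : ∀ w, L w = ∑ b, w b • (b.1 - a) := fun w => by simp [L]
  let L' := LinearMap.toContinuousLinearMap L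
  have hsub : hull A ⊆ (fun x => a + x) '' (L' '' Set.Icc 0 1) := by
    intro x hx
    obtain ⟨w, hw0, hw1, rfl⟩ := Finset.mem_convexHull'.1 hx
    refine ⟨_, ⟨fun b => w b.1, ⟨fun b => hw0 _ (Finset.mem_of_mem_erase b.2), fun b => ?_⟩, rfl⟩,
      ?_⟩
    · rw [Pi.one_apply, ← hw1]
      exact Finset.single_le_sum (f := w) hw0 (Finset.mem_of_mem_erase b.2)
    · have h1 : L' (fun b => w b.1) = ∑ b ∈ A, w b • (b - a) := by
        change L _ = _
        rw [hL, Finset.sum_coe_sort (A.erase a) (fun b => w b • (b - a)),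
          ← Finset.add_sum_erase A _ ha]
        simp
      simp only [h1, smul_sub, Finset.sum_sub_distrib, ← Finset.sum_smul, hw1, one_smul]
      abel
  refine (measure_mono hsub).trans_lt ?_
  rw [(isometry_add_left a).hausdorffMeasure_image (Or.inl (by positivity))]
  refine (L'.lipschitz.hausdorffMeasure_image_le (by positivity) _).trans_lt ?_
  refine ENNReal.mul_lt_top (by simp) ?_
  rw [← hcard, hausdorffMeasure_pi_real]
  exact isCompact_Icc.measure_lt_top

theorem SimplicialMesh.card_face (M : SimplicialMesh d Ω) (F : M.faces) : F.1.card = d := by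
  classical
  obtain ⟨K, -, hF⟩ := Finset.mem_biUnion.1 F.2
  exact (Finset.mem_powersetCard.1 hF).2

instance (M : SimplicialMesh d Ω) (F : M.faces) : IsFiniteMeasure (M.faceMeasure F) := by
  refine ⟨?_⟩
  rw [SimplicialMesh.faceMeasure, Measure.restrict_apply_univ]
  rcases Nat.eq_zero_or_pos d with rfl | hd
  · have hF : F.1 = ∅ := Finset.card_eq_zero.1 (M.card_face F)
    simp [hF, hull]
  · rw [Measure.euclideanHausdorffMeasure_def, Measure.smul_apply]
    refine ENNReal.mul_lt_top (by simp) ?_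
    exact hausdorffMeasure_hull_lt_top F.1 (by rw [M.card_face F]; omega)

theorem memLp_face (M : SimplicialMesh d Ω) (F : M.faces) {f : Space d → ℝ} (hf : Continuous f) :
    MemLp f 2 (M.faceMeasure F) := by
  obtain ⟨C, hC⟩ := (isCompact_hull F.1).exists_bound_of_continuousOn hf.continuousOn
  refine MemLp.of_bound hf.aestronglyMeasurable C ?_
  exact (ae_restrict_iff' (isCompact_hull F.1).measurableSet).2 (.of_forall hC)

theorem integrableOn_cell (A : Finset (Space d)) {f : Space d → ℝ} (hf : Continuous f) :
    IntegrableOn f (hull A) :=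
  hf.continuousOn.integrableOn_compact (isCompact_hull A)

theorem SimplicialMesh.interior_nonempty (M : SimplicialMesh d Ω) (K : M.cells) :
    (interior (hull K.1)).Nonempty := by
  rw [interior_convexHull_nonempty_iff_affineSpan_eq_top]
  have h := (M.affineIndependent K.1 K.2).affineSpan_eq_top_iff_card_eq_finrank_add_one.2
    (by simp [M.card_eq K.1 K.2])
  simpa using h

theorem eq_zero_of_eqOn_open {q : MvPolynomial (Fin d) ℝ} {U : Set (Space d)} (hU : IsOpen U)
    (hne : U.Nonempty) (hq : ∀ x ∈ U, polyFun q x = 0) : q = 0 := by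
  obtain ⟨x, hx⟩ := hne
  have hV : IsOpen ((WithLp.toLp 2 : (Fin d → ℝ) → Space d) ⁻¹' U) :=
    hU.preimage (PiLp.continuous_toLp 2 _)
  obtain ⟨ε, hε, hball⟩ := Metric.isOpen_iff.1 hV x.ofLp (by simpa using hx)
  refine MvPolynomial.funext_set (fun i => Metric.ball (x i) ε) (fun i => ?_) fun y hy => ?_
  · rw [Real.ball_eq_Ioo]
    exact Set.Ioo_infinite (by linarith)
  · have hy' : y ∈ Metric.ball x.ofLp ε := by
      rw [ball_pi _ hε]; exact hy
    simpa [polyFun] using hq _ (hball hy')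

theorem eq_zero_of_integral_eq_zero (M : SimplicialMesh d Ω) (K : M.cells) {f : Space d → ℝ}
    (hf : Continuous f) (h0 : ∀ x, 0 ≤ f x) (h : ∫ x in hull K.1, f x = 0) :
    ∀ x ∈ interior (hull K.1), f x = 0 := by
  have h1 := (setIntegral_eq_zero_iff_of_nonneg_ae (.of_forall h0)
    (integrableOn_cell K.1 hf)).1 h
  have h2 : f =ᵐ[volume.restrict (interior (hull K.1))] 0 :=
    ae_restrict_of_ae_restrict_of_subset interior_subset h1
  exact Measure.eqOn_open_of_ae_eq h2 isOpen_interior hf.continuousOn continuousOn_const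

theorem eq_C_of_pderiv_eq_zero {q : MvPolynomial (Fin d) ℝ}
    (hq : ∀ i, MvPolynomial.pderiv i q = 0) : q = MvPolynomial.C (MvPolynomial.coeff 0 q) := by
  classical
  ext m
  rw [MvPolynomial.coeff_C]
  split_ifs with hm
  · rw [hm]
  · obtain ⟨i, hi⟩ : ∃ i, m i ≠ 0 := by
      by_contra! h
      exact hm (Finsupp.ext fun i => by simp [h i])
    have h := MvPolynomial.coeff_pderiv (i := i) q (m - Finsupp.single i 1)
    have hle : Finsupp.single i 1 ≤ m := by
      rw [Finsupp.single_le_iff]; omega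
    rw [hq i, tsub_add_cancel_of_le hle, MvPolynomial.coeff_zero] at h
    have hne : (((m - Finsupp.single i 1 : Fin d →₀ ℕ) i : ℝ) + 1) ≠ 0 := by positivity
    exact (mul_eq_zero.1 h.symm).resolve_right hne

theorem exists_representer {V : Type*} [AddCommGroup V] [Module ℝ V] [FiniteDimensional ℝ V]
    (B : V →ₗ[ℝ] V →ₗ[ℝ] ℝ) (hB : ∀ v, B v v = 0 → v = 0) (l : V →ₗ[ℝ] ℝ) :
    ∃ v, ∀ w, B v w = l w := by
  have hinj : Function.Injective B := by
    rw [← LinearMap.ker_eq_bot, LinearMap.ker_eq_bot']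
    intro v hv
    exact hB v (by rw [hv]; rfl)
  have hsurj := (LinearMap.injective_iff_surjective_of_finrank_eq_finrank
    (Subspace.dual_finrank_eq (K := ℝ) (V := V)).symm).1 hinj
  obtain ⟨v, hv⟩ := hsurj l
  exact ⟨v, fun w => by rw [hv]⟩

/-! ### Face polynomials and the hybrid space -/

/-- The restriction of a polynomial to the face `F`, as an element of `L²(F)`. -/
def SimplicialMesh.faceRestrict (M : SimplicialMesh d Ω) (F : M.faces) :
    MvPolynomial (Fin d) ℝ →ₗ[ℝ] Lp ℝ 2 (M.faceMeasure F) where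
  toFun q := (memLp_face M F (continuous_polyFun q)).toLp
  map_add' q r := by
    rw [← MemLp.toLp_add]
    congr 1
    funext x
    exact polyFun_add q r x
  map_smul' c q := by
    rw [RingHom.id_apply, ← MemLp.toLp_const_smul]
    congr 1
    funext x
    exact polyFun_smul c q x

/-- `ℙ_n(F)`: restrictions to the face `F` of polynomials of total degree at most `n`, as a
finite-dimensional subspace of `L²(F)`. -/
abbrev SimplicialMesh.FacePoly (M : SimplicialMesh d Ω) (n : ℕ) (F : M.faces) :
    Submodule ℝ (Lp ℝ 2 (M.faceMeasure F)) :=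
  (Poly d n).map (M.faceRestrict F)

/-- The hybrid space `ℙ_p(M) × ℙ_p(Σ)`: one polynomial of degree at most `p` on each cell and
one polynomial of degree at most `p` on each face, the latter being zero on the boundary faces. -/
def SimplicialMesh.HybridSpace (M : SimplicialMesh d Ω) (p : ℕ) :
    Submodule ℝ ((∀ _ : M.cells, Poly d p) × (∀ F : M.faces, M.FacePoly p F)) where
  carrier := {s | ∀ F, ¬ M.IsInterface F → s.2 F = 0}
  add_mem' hs hσ F hF := by simp [hs F hF, hσ F hF]
  zero_mem' F _ := rfl
  smul_mem' c s hs F hF := by simp [hs F hF]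

variable {M : SimplicialMesh d Ω} {p : ℕ}

/-- The cell component `(s_M)|_K`. -/
def cellPart (s : M.HybridSpace p) (K : M.cells) : MvPolynomial (Fin d) ℝ := (s.1.1 K).1

/-- The face component `(s_Σ)|_F`. -/
def facePart (s : M.HybridSpace p) (F : M.faces) : Lp ℝ 2 (M.faceMeasure F) := (s.1.2 F).1

/-! ### The `L²` projections -/

theorem exists_cellProjection (M : SimplicialMesh d Ω) (n : ℕ) (K : M.cells)
    (r : MvPolynomial (Fin d) ℝ) :
    ∃ π : Poly d n, ∀ q ∈ Poly d n,
      ∫ x in hull K.1, polyFun q x * polyFun π.1 x = ∫ x in hull K.1, polyFun q x * polyFun r x := by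
  have hint : ∀ q q' : MvPolynomial (Fin d) ℝ,
      IntegrableOn (fun x => polyFun q x * polyFun q' x) (hull K.1) := fun q q' =>
    integrableOn_cell _ ((continuous_polyFun q).mul (continuous_polyFun q'))
  let B : Poly d n →ₗ[ℝ] Poly d n →ₗ[ℝ] ℝ :=
    LinearMap.mk₂ ℝ (fun r q => ∫ x in hull K.1, polyFun q.1 x * polyFun r.1 x)
      (fun r r' q => by
        simp only [Submodule.coe_add, polyFun_add, mul_add]
        exact integral_add (hint _ _) (hint _ _))
      (fun c r q => by
        simp only [Submodule.coe_smul, polyFun_smul, mul_left_comm _ c, smul_eq_mul]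
        exact integral_const_mul _ _)
      (fun r q q' => by
        simp only [Submodule.coe_add, polyFun_add, add_mul]
        exact integral_add (hint _ _) (hint _ _))
      (fun c r q => by
        simp only [Submodule.coe_smul, polyFun_smul, mul_assoc, smul_eq_mul]
        exact integral_const_mul _ _)
  let l : Poly d n →ₗ[ℝ] ℝ :=
    { toFun := fun q => ∫ x in hull K.1, polyFun q.1 x * polyFun r x
      map_add' := fun q q' => by
        simp only [Submodule.coe_add, polyFun_add, add_mul]
        exact integral_add (hint _ _) (hint _ _)
      map_smul' := fun c q => by
        simp only [Submodule.coe_smul, polyFun_smul, mul_assoc, smul_eq_mul, RingHom.id_apply]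
        exact integral_const_mul _ _ }
  obtain ⟨π, hπ⟩ := exists_representer B (fun v hv => Subtype.ext <|
    eq_zero_of_eqOn_open isOpen_interior (M.interior_nonempty K) fun x hx =>
      mul_self_eq_zero.1 <| eq_zero_of_integral_eq_zero M K
        ((continuous_polyFun v.1).mul (continuous_polyFun v.1))
        (fun x => mul_self_nonneg _) hv x hx) l
  exact ⟨π, fun q hq => hπ ⟨q, hq⟩⟩

/-- The local `L²(K)`-orthogonal projection of the polynomial `r` onto `ℙ_n(K)`. -/
def cellProj (M : SimplicialMesh d Ω) (n : ℕ) (K : M.cells) (r : MvPolynomial (Fin d) ℝ) :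
    MvPolynomial (Fin d) ℝ :=
  (exists_cellProjection M n K r).choose.1

/-- The local `L²(F)`-orthogonal projection onto `ℙ_n(F)`. -/
def faceProj (M : SimplicialMesh d Ω) (n : ℕ) (F : M.faces) (g : Lp ℝ 2 (M.faceMeasure F)) :
    Lp ℝ 2 (M.faceMeasure F) :=
  (M.FacePoly n F).starProjection g

/-! ### The reconstruction -/

/-- The functional `q ↦ -∫_K s_M Δq + ∫_{∂K} s_Σ ∇q · n_K`. -/
def reconstructionRhs (s : M.HybridSpace p) (K : M.cells) (q : MvPolynomial (Fin d) ℝ) : ℝ :=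
  -(∫ x in hull K.1, polyFun (cellPart s K) x * polyFun (polyLaplacian q) x)
    + ∑ a : K.1, ∫ x, facePart s (M.facet K a) x * ⟪polyGrad q x, M.normal K a⟫_ℝ
        ∂(M.faceMeasure (M.facet K a))

/-- `r ∈ ℙ_{p+1}(K)` satisfies the two conditions that define the reconstruction of `s`
in the cell `K`. -/
def IsReconstruction (s : M.HybridSpace p) (K : M.cells) (r : Poly d (p + 1)) : Prop :=
  (∀ q ∈ Poly d (p + 1),
    ∫ x in hull K.1, ⟪polyGrad r.1 x, polyGrad q x⟫_ℝ = reconstructionRhs s K q) ∧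
  ∫ x in hull K.1, polyFun r.1 x = ∫ x in hull K.1, polyFun (cellPart s K) x

theorem integrable_facePart_mul (s : M.HybridSpace p) (F : M.faces) {g : Space d → ℝ}
    (hg : Continuous g) : Integrable (fun x => facePart s F x * g x) (M.faceMeasure F) :=
  (Lp.memLp (facePart s F)).integrable_mul (memLp_face M F hg)

theorem exists_reconstruction (s : M.HybridSpace p) (K : M.cells) :
    ∃ r : Poly d (p + 1), IsReconstruction s K r := by
  have hG : ∀ q q' : MvPolynomial (Fin d) ℝ,
      IntegrableOn (fun x => ⟪polyGrad q x, polyGrad q' x⟫_ℝ) (hull K.1) := fun q q' =>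
    integrableOn_cell _ ((continuous_polyGrad q).inner (continuous_polyGrad q'))
  have hI : ∀ q : MvPolynomial (Fin d) ℝ, IntegrableOn (polyFun q) (hull K.1) := fun q =>
    integrableOn_cell _ (continuous_polyFun q)
  have hM : ∀ q q' : MvPolynomial (Fin d) ℝ,
      IntegrableOn (fun x => polyFun q x * polyFun q' x) (hull K.1) := fun q q' =>
    integrableOn_cell _ ((continuous_polyFun q).mul (continuous_polyFun q'))
  have hF : ∀ (a : K.1) (q : MvPolynomial (Fin d) ℝ),
      Integrable (fun x => facePart s (M.facet K a) x * ⟪polyGrad q x, M.normal K a⟫_ℝ)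
        (M.faceMeasure (M.facet K a)) := fun a q =>
    integrable_facePart_mul s _ ((continuous_polyGrad q).inner continuous_const)
  have Gadd : ∀ q q' r : MvPolynomial (Fin d) ℝ,
      ∫ x in hull K.1, ⟪polyGrad (q + q') x, polyGrad r x⟫_ℝ =
        (∫ x in hull K.1, ⟪polyGrad q x, polyGrad r x⟫_ℝ)
          + ∫ x in hull K.1, ⟪polyGrad q' x, polyGrad r x⟫_ℝ := fun q q' r => by
    simp only [polyGrad_add, inner_add_left]
    exact integral_add (hG _ _) (hG _ _)
  have Gsmul : ∀ (c : ℝ) (q r : MvPolynomial (Fin d) ℝ),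
      ∫ x in hull K.1, ⟪polyGrad (c • q) x, polyGrad r x⟫_ℝ =
        c * ∫ x in hull K.1, ⟪polyGrad q x, polyGrad r x⟫_ℝ := fun c q r => by
    simp only [polyGrad_smul, real_inner_smul_left]
    exact integral_const_mul _ _
  have Gcomm : ∀ q r : MvPolynomial (Fin d) ℝ,
      ∫ x in hull K.1, ⟪polyGrad q x, polyGrad r x⟫_ℝ =
        ∫ x in hull K.1, ⟪polyGrad r x, polyGrad q x⟫_ℝ := fun q r => by
    simp only [real_inner_comm]
  have Iadd : ∀ q q' : MvPolynomial (Fin d) ℝ,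
      ∫ x in hull K.1, polyFun (q + q') x =
        (∫ x in hull K.1, polyFun q x) + ∫ x in hull K.1, polyFun q' x := fun q q' => by
    simp only [polyFun_add]
    exact integral_add (hI _) (hI _)
  have Ismul : ∀ (c : ℝ) (q : MvPolynomial (Fin d) ℝ),
      ∫ x in hull K.1, polyFun (c • q) x = c * ∫ x in hull K.1, polyFun q x := fun c q => by
    simp only [polyFun_smul]
    exact integral_const_mul _ _
  let B : Poly d (p + 1) →ₗ[ℝ] Poly d (p + 1) →ₗ[ℝ] ℝ :=
    LinearMap.mk₂ ℝ (fun r q => (∫ x in hull K.1, ⟪polyGrad r.1 x, polyGrad q.1 x⟫_ℝ)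
        + (∫ x in hull K.1, polyFun r.1 x) * ∫ x in hull K.1, polyFun q.1 x)
      (fun r r' q => by
        simp only [Submodule.coe_add, Gadd, Iadd]; ring)
      (fun c r q => by
        simp only [Submodule.coe_smul, Gsmul, Ismul, smul_eq_mul]; ring)
      (fun r q q' => by
        simp only [Submodule.coe_add, Gcomm r.1, Gadd, Iadd]; ring)
      (fun c r q => by
        simp only [Submodule.coe_smul, Gcomm r.1, Gsmul, Ismul, smul_eq_mul]; ring)
  let l : Poly d (p + 1) →ₗ[ℝ] ℝ :=
    { toFun := fun q => reconstructionRhs s K q.1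
          + (∫ x in hull K.1, polyFun (cellPart s K) x) * ∫ x in hull K.1, polyFun q.1 x
      map_add' := fun q q' => by
        rw [Submodule.coe_add, Iadd]
        simp only [reconstructionRhs, polyLaplacian_add, polyFun_add, polyGrad_add,
          inner_add_left, mul_add]
        rw [integral_add (hM _ _) (hM _ _),
          Finset.sum_congr rfl fun a _ => integral_add (hF a q.1) (hF a q'.1),
          Finset.sum_add_distrib]
        ring
      map_smul' := fun c q => by
        rw [Submodule.coe_smul, Ismul]
        simp only [reconstructionRhs, polyLaplacian_smul, polyFun_smul,
          polyGrad_smul, real_inner_smul_left, mul_left_comm _ c, integral_const_mul,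
          ← Finset.mul_sum, smul_eq_mul, RingHom.id_apply]
        ring }
  have hvol : (∫ _ in hull K.1, (1 : ℝ)) ≠ 0 := fun h => by
    obtain ⟨x, hx⟩ := M.interior_nonempty K
    exact one_ne_zero (eq_zero_of_integral_eq_zero M K (f := fun _ => (1 : ℝ)) continuous_const
      (fun _ => zero_le_one) h x hx)
  have hC : ∀ c : ℝ, ∫ x in hull K.1, polyFun (MvPolynomial.C c) x
      = c * ∫ _ in hull K.1, (1 : ℝ) := fun c => by
    simp [polyFun, mul_comm]
  have hgC : ∀ (c : ℝ) (x : Space d), polyGrad (MvPolynomial.C c) x = 0 := fun c x => by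
    ext i; simp [polyGrad, polyFun]
  have hB : ∀ v, B v v = 0 → v = 0 := fun v hv => by
    have hv' : (∫ x in hull K.1, ⟪polyGrad v.1 x, polyGrad v.1 x⟫_ℝ)
        + (∫ x in hull K.1, polyFun v.1 x) * (∫ x in hull K.1, polyFun v.1 x) = 0 := hv
    have h1 : 0 ≤ ∫ x in hull K.1, ⟪polyGrad v.1 x, polyGrad v.1 x⟫_ℝ :=
      integral_nonneg fun x => real_inner_self_nonneg
    have h2 := mul_self_nonneg (∫ x in hull K.1, polyFun v.1 x)
    have h3 := eq_zero_of_integral_eq_zero M K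
      ((continuous_polyGrad v.1).inner (continuous_polyGrad v.1))
      (fun x => real_inner_self_nonneg) (by linarith)
    have h4 := eq_C_of_pderiv_eq_zero (q := v.1) fun i =>
      eq_zero_of_eqOn_open isOpen_interior (M.interior_nonempty K) fun x hx => by
        have h5 : polyGrad v.1 x = 0 := inner_self_eq_zero.1 (h3 x hx)
        simpa [polyGrad] using congrArg (fun y : Space d => y i) h5
    have h6 : ∫ x in hull K.1, polyFun v.1 x = 0 := mul_self_eq_zero.1 (by linarith)
    rw [h4, hC] at h6
    rw [(mul_eq_zero.1 h6).resolve_right hvol, MvPolynomial.C_0] at h4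
    exact Subtype.ext h4
  obtain ⟨r, hr⟩ := exists_representer B hB l
  have hr' : ∀ q ∈ Poly d (p + 1), (∫ x in hull K.1, ⟪polyGrad r.1 x, polyGrad q x⟫_ℝ)
      + (∫ x in hull K.1, polyFun r.1 x) * (∫ x in hull K.1, polyFun q x)
      = reconstructionRhs s K q
          + (∫ x in hull K.1, polyFun (cellPart s K) x) * ∫ x in hull K.1, polyFun q x :=
    fun q hq => hr ⟨q, hq⟩
  have havg : ∫ x in hull K.1, polyFun r.1 x = ∫ x in hull K.1, polyFun (cellPart s K) x := by
    have h := hr' (MvPolynomial.C 1) (by simp [MvPolynomial.mem_restrictTotalDegree])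
    have h0 : reconstructionRhs s K (MvPolynomial.C 1) = 0 := by
      simp only [reconstructionRhs, hgC, inner_zero_left]
      simp [polyLaplacian, polyFun]
    simp only [h0, hC, hgC, inner_zero_right, integral_zero, zero_add, one_mul] at h
    exact mul_right_cancel₀ hvol h
  refine ⟨r, fun q hq => ?_, havg⟩
  have h := hr' q hq
  rw [havg] at h
  exact add_right_cancel h

/-- The reconstruction `(R s)|_K ∈ ℙ_{p+1}(K)`. -/
def reconstruction (s : M.HybridSpace p) (K : M.cells) : MvPolynomial (Fin d) ℝ :=
  (exists_reconstruction s K).choose.1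

/-! ### The stabilization and the discrete form -/

/-- The stabilization operator `(S s)|_K = s_M + (Id - Π_M) R s`. -/
def stabOperator (s : M.HybridSpace p) (K : M.cells) : MvPolynomial (Fin d) ℝ :=
  cellPart s K + (reconstruction s K - cellProj M p K (reconstruction s K))

/-- `Π_F (s_Σ - (S s)|_K)` on the face `F` of `K` opposite to the vertex `a`. -/
def faceResidual (s : M.HybridSpace p) (K : M.cells) (a : K.1) :
    Lp ℝ 2 (M.faceMeasure (M.facet K a)) :=
  faceProj M p (M.facet K a)
    (facePart s (M.facet K a) - M.faceRestrict (M.facet K a) (stabOperator s K))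

/-- The stabilization bilinear form, with the weight `w F` on the face `F`. -/
def stab (w : M.faces → ℝ) (s σ : M.HybridSpace p) : ℝ :=
  ∑ K : M.cells, ∑ a : K.1,
    w (M.facet K a) * ∫ x, faceResidual s K a x * faceResidual σ K a x
      ∂(M.faceMeasure (M.facet K a))

/-- The discrete bilinear form `b(s, σ) = ∫_Ω ∇_M R s · ∇_M R σ + S(s, σ)`. -/
def discreteForm (w : M.faces → ℝ) (s σ : M.HybridSpace p) : ℝ :=
  (∑ K : M.cells, ∫ x in hull K.1,
    ⟪polyGrad (reconstruction s K) x, polyGrad (reconstruction σ K) x⟫_ℝ) + stab w s σ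

/-! ### The Sobolev space `H¹₀(Ω)` and traces on the faces -/

theorem memLp_test {F : Type*} [NormedAddCommGroup F] {f : Space d → F} (hf : Continuous f)
    (hc : HasCompactSupport f) (μ : Measure (Space d)) [IsFiniteMeasureOnCompacts μ] :
    MemLp f 2 μ :=
  hf.memLp_of_hasCompactSupport hc

theorem continuous_gradient (φ : 𝓓(Ω, ℝ)) : Continuous (gradient φ) :=
  (InnerProductSpace.toDual ℝ (Space d)).symm.continuous.comp
    (φ.contDiff.continuous_fderiv (by simp))

theorem hasCompactSupport_gradient (φ : 𝓓(Ω, ℝ)) : HasCompactSupport (gradient φ) :=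
  (φ.hasCompactSupport.fderiv ℝ).comp_left (map_zero _)

/-- A test function `φ ∈ C_c^∞(Ω)` together with its gradient, in `L²(Ω) × L²(Ω)^d`. -/
def testPair (Ω : Opens (Space d)) :
    𝓓(Ω, ℝ) →ₗ[ℝ] Lp ℝ 2 (volume.restrict (Ω : Set (Space d)))
      × Lp (Space d) 2 (volume.restrict (Ω : Set (Space d))) where
  toFun φ := ((memLp_test φ.continuous φ.hasCompactSupport _).toLp,
    (memLp_test (continuous_gradient φ) (hasCompactSupport_gradient φ) _).toLp)
  map_add' φ ψ := by
    refine Prod.ext ?_ ?_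
    · exact MemLp.toLp_add (memLp_test φ.continuous φ.hasCompactSupport _)
        (memLp_test ψ.continuous ψ.hasCompactSupport _)
    · refine Eq.trans ?_ (MemLp.toLp_add
        (memLp_test (continuous_gradient φ) (hasCompactSupport_gradient φ) _)
        (memLp_test (continuous_gradient ψ) (hasCompactSupport_gradient ψ) _))
      refine MemLp.toLp_congr
        (memLp_test (continuous_gradient (φ + ψ)) (hasCompactSupport_gradient (φ + ψ)) _) _
        (.of_eq ?_)
      funext x
      simp only [gradient, Pi.add_apply]
      rw [show ((φ + ψ : 𝓓(Ω, ℝ)) : Space d → ℝ) = ⇑φ + ⇑ψ from rfl,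
        fderiv_add (φ.contDiff.differentiable (by simp) x) (ψ.contDiff.differentiable (by simp) x),
        map_add]
  map_smul' c φ := by
    refine Prod.ext ?_ ?_
    · exact MemLp.toLp_const_smul c (memLp_test φ.continuous φ.hasCompactSupport _)
    · refine Eq.trans ?_ (MemLp.toLp_const_smul c
        (memLp_test (continuous_gradient φ) (hasCompactSupport_gradient φ) _))
      refine MemLp.toLp_congr
        (memLp_test (continuous_gradient (c • φ)) (hasCompactSupport_gradient (c • φ)) _) _
        (.of_eq ?_)
      funext x
      simp only [gradient, Pi.smul_apply]
      rw [show ((c • φ : 𝓓(Ω, ℝ)) : Space d → ℝ) = c • ⇑φ from rfl,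
        fderiv_const_smul (φ.contDiff.differentiable (by simp) x), map_smul]

/-- The space `H¹₀(Ω)`: the closure of the test functions in the `H¹`-norm. An element is stored
as the pair `(v, ∇v)` of the function and its (weak) gradient, and the norm is the one of
`L²(Ω) × L²(Ω)^d`, which is equivalent to the `H¹`-norm. -/
def H10 (Ω : Opens (Space d)) :
    Submodule ℝ (Lp ℝ 2 (volume.restrict (Ω : Set (Space d)))
      × Lp (Space d) 2 (volume.restrict (Ω : Set (Space d)))) :=
  (LinearMap.range (testPair Ω)).topologicalClosure

/-- A test function as an element of `H¹₀(Ω)`. -/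
def testToH10 (Ω : Opens (Space d)) : 𝓓(Ω, ℝ) →ₗ[ℝ] H10 Ω :=
  (testPair Ω).codRestrict (H10 Ω) fun φ =>
    Submodule.le_topologicalClosure _ (LinearMap.mem_range_self _ φ)

/-- The function underlying an element of `H¹₀(Ω)`. -/
def H10.val (v : H10 Ω) : Space d → ℝ := v.1.1

/-- The weak gradient of an element of `H¹₀(Ω)`. -/
def H10.grad (v : H10 Ω) : Space d → Space d := v.1.2

/-- The restriction of a test function to the face `F`, as an element of `L²(F)`. -/
def testRestrict (M : SimplicialMesh d Ω) (F : M.faces) :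
    𝓓(Ω, ℝ) →ₗ[ℝ] Lp ℝ 2 (M.faceMeasure F) where
  toFun φ := (memLp_test φ.continuous φ.hasCompactSupport _).toLp
  map_add' φ ψ := MemLp.toLp_add (memLp_test φ.continuous φ.hasCompactSupport _)
    (memLp_test ψ.continuous ψ.hasCompactSupport _)
  map_smul' c φ := MemLp.toLp_const_smul c (memLp_test φ.continuous φ.hasCompactSupport _)

/-- The trace `H¹₀(Ω) → L²(F)` on the face `F`: the continuous linear extension of the
restriction to `F` of test functions. -/
def trace (M : SimplicialMesh d Ω) (F : M.faces) : H10 Ω →L[ℝ] Lp ℝ 2 (M.faceMeasure F) :=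
  (testRestrict M F).extendOfNorm (testToH10 Ω)

/-! ### The extended form, the problems and the smoother -/

/-- The extended bilinear form `ã` on `V + H`, where `V` is the space of the pairs `(v, v|_Σ)`
with `v ∈ H¹₀(Ω)`, and `H` is the hybrid space: `extendedForm w v s v' σ` is
`ã(v + s, v' + σ) = ∫_Ω ∇_M (v + R s) · ∇_M (v' + R σ) + S(s, σ)`. -/
def extendedForm (w : M.faces → ℝ) (v : H10 Ω) (s : M.HybridSpace p) (v' : H10 Ω)
    (σ : M.HybridSpace p) : ℝ :=
  (∑ K : M.cells, ∫ x in hull K.1,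
    ⟪H10.grad v x + polyGrad (reconstruction s K) x,
      H10.grad v' x + polyGrad (reconstruction σ K) x⟫_ℝ) + stab w s σ

/-- The extended energy semi-norm `|v + s| = √(ã(v + s, v + s))`. -/
def extendedNorm (w : M.faces → ℝ) (v : H10 Ω) (s : M.HybridSpace p) : ℝ :=
  √(extendedForm w v s v s)

/-- `u ∈ H¹₀(Ω)` solves the Poisson problem with load `f ∈ H⁻¹(Ω)`. -/
def IsPoissonSolution (f : StrongDual ℝ (H10 Ω)) (u : H10 Ω) : Prop :=
  ∀ v : H10 Ω, ∫ x in (Ω : Set (Space d)), ⟪H10.grad u x, H10.grad v x⟫_ℝ = f v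

/-- `U` solves the modified discrete problem with smoother `E` and load `f ∈ H⁻¹(Ω)`. -/
def IsDiscreteSolution (w : M.faces → ℝ) (E : M.HybridSpace p →ₗ[ℝ] H10 Ω)
    (f : StrongDual ℝ (H10 Ω)) (U : M.HybridSpace p) : Prop :=
  ∀ σ : M.HybridSpace p, discreteForm w U σ = f (E σ)

/-- The smoother `E` preserves the moments of degree at most `p - 1` in the cells (none if
`p = 0`) and the moments of degree at most `p` on the interfaces. -/
def PreservesMoments (E : M.HybridSpace p →ₗ[ℝ] H10 Ω) : Prop :=
  ∀ σ : M.HybridSpace p,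
    (∀ (K : M.cells) (q : MvPolynomial (Fin d) ℝ), q.totalDegree < p →
      ∫ x in hull K.1, polyFun q x * H10.val (E σ) x
        = ∫ x in hull K.1, polyFun q x * polyFun (cellPart σ K) x) ∧
    (∀ F : M.faces, M.IsInterface F → ∀ r ∈ Poly d p,
      ∫ x, polyFun r x * trace M F (E σ) x ∂(M.faceMeasure F)
        = ∫ x, polyFun r x * facePart σ F x ∂(M.faceMeasure F))

/-- The norm `‖∇_M (R σ - E σ)‖` in `L²(Ω)`. -/
def smoothingError (E : M.HybridSpace p →ₗ[ℝ] H10 Ω) (σ : M.HybridSpace p) : ℝ :=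
  √(∑ K : M.cells, ∫ x in hull K.1,
    ‖polyGrad (reconstruction σ K) x - H10.grad (E σ) x‖ ^ 2)

end HHO

end

open MeasureTheory TopologicalSpace
open scoped InnerProductSpace Distributions

noncomputable section

namespace HHO

variable {d : ℕ} {Ω : Opens (Space d)}

/-! Write G s for the cell-wise gradient of R s, T s for the face residuals weighted by √w, and P σ
for the gradient of E σ, so that b(s, σ) = ⟪G s, G σ⟫ + ⟪T s, T σ⟫. The moment conditions serve only
to give ⟪G τ, P σ⟫ = ⟪G τ, G σ⟫ (`inner_discreteGrad_brokenGrad`). Indeed, with q = R τ on a cell K,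
integrate ∇q · ∇(E σ) by parts. Since Δq has degree at most p - 1 and ∇q · n_K has degree at most p
on each face, the moments of E σ may be replaced by those of σ, and the result is the right-hand
side that defines R σ.

The error bound is then Hilbert space geometry (`quasiOptimality`). The best approximation s₀ of u
solves the discrete problem with load ⟪∇u, G σ⟫, whereas U solves it with load ⟪∇u, P σ⟫. For σ = U
- s₀ the difference of the two equations reads b(σ, σ) = ⟪∇u - G s₀, P σ - G σ⟫, where G s₀ may be
inserted by the identity above. Cauchy-Schwarz bounds |U - s₀| by C_H times the best error, and
Pythagoras produces the factor √(1 + C_H²).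

Unique solvability and the existence of C_H follow, in finite dimension, from definiteness of b
(`eq_zero_of_energy_eq_zero`). If b(s, s) = 0, then R s is constant on each cell, hence s_F is the
restriction of s_K, hence s_K is a constant c_K. Instead of propagating zero from the boundary
through neighbouring cells, the divergence theorem is applied to the field c_K² x_i e_i: the fluxes
cancel on interfaces and vanish on boundary faces, so ∑ c_K² |K| = 0.

The analytic tools all come from one identity on a simplex seen as a cone with apex a
(`integral_cone_radial`): the radial field f(x) (x - a) has flux only through the face opposite to
a. Combining it over all vertices gives the divergence theorem on a cell; taking f = φ² gives the
trace inequality. Density of test functions carries integration by parts over to H¹₀(Ω). -/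

/-! ### Integration over cones -/

/-- The cone with apex `a` and base `S`. -/
def cone (a : Space d) (S : Set (Space d)) : Set (Space d) :=
  (fun z : ℝ × Space d => a + z.1 • (z.2 - a)) '' (Set.Icc 0 1 ×ˢ S)

/-- The measure `t ^ (d - 1) dt` on `(0, 1]`. -/
def radialMeasure (d : ℕ) : Measure ℝ :=
  (volume.restrict (Set.Ioc 0 1)).withDensity fun t => ENNReal.ofReal (t ^ (d - 1))

theorem continuous_coneMap (a : Space d) :
    Continuous fun z : ℝ × Space d => a + z.1 • (z.2 - a) := by fun_prop

theorem isCompact_cone (a : Space d) {S : Set (Space d)} (hS : IsCompact S) :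
    IsCompact (cone a S) :=
  (isCompact_Icc.prod hS).image (continuous_coneMap a)

instance (d : ℕ) : IsFiniteMeasure (radialMeasure d) := by
  refine isFiniteMeasure_withDensity_ofReal ?_
  refine HasFiniteIntegral.of_bounded (C := 1) ?_
  refine (ae_restrict_iff' measurableSet_Ioc).2 (.of_forall fun t ht => ?_)
  rw [Real.norm_of_nonneg (pow_nonneg ht.1.le _)]
  exact pow_le_one₀ ht.1.le ht.2

/-- The height of a + s (y - a) above the apex is s h, so the hyperplane at height t h selects
exactly the parameter s = t. The slice t = 0 is left out; it is negligible in the integration over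
t. -/
theorem cone_inter_slice {a n : Space d} {h : ℝ} {S : Set (Space d)} (hn : ‖n‖ = 1) (hh : 0 < h)
    (hS : ∀ y ∈ S, ⟪n, y - a⟫_ℝ = h) (t : ℝ) (ht : t ≠ 0) :
    cone a S ∩ AffineSubspace.mk' (t • (h • n) +ᵥ a) (ℝ ∙ (h • n))ᗮ =
      if t ∈ Set.Ioc (0 : ℝ) 1 then AffineMap.homothety a t '' S else ∅ := by
  have key : ∀ x, x ∈ AffineSubspace.mk' (t • (h • n) +ᵥ a) (ℝ ∙ (h • n))ᗮ ↔
      ⟪n, x - a⟫_ℝ = t * h := by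
    intro x
    rw [AffineSubspace.mem_mk', Submodule.mem_orthogonal_singleton_iff_inner_right]
    rw [real_inner_smul_left, mul_eq_zero, or_iff_right hh.ne', vsub_eq_sub, vadd_eq_add,
      add_comm _ a, ← sub_sub, inner_sub_right, inner_smul_right, inner_smul_right,
      real_inner_self_eq_norm_sq, hn, one_pow, mul_one, sub_eq_zero]
  have hin : ∀ (s : ℝ), ∀ y ∈ S, ⟪n, a + s • (y - a) - a⟫_ℝ = s * h := fun s y hy => by
    rw [add_sub_cancel_left, inner_smul_right, hS y hy]
  have hhom : ∀ (s : ℝ) (y : Space d), AffineMap.homothety a s y = a + s • (y - a) := fun s y => by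
    rw [AffineMap.homothety_apply, vsub_eq_sub, vadd_eq_add, add_comm]
  ext x
  simp only [Set.mem_inter_iff, SetLike.mem_coe, key]
  constructor
  · rintro ⟨⟨⟨s, y⟩, ⟨hs, hy⟩, rfl⟩, hx⟩
    have hst : s = t := by
      have := hin s y hy
      exact mul_right_cancel₀ hh.ne' (this.symm.trans hx)
    subst hst
    rw [if_pos ⟨lt_of_le_of_ne hs.1 ht.symm, hs.2⟩]
    exact ⟨y, hy, hhom _ _⟩
  · split_ifs with h1
    · rintro ⟨y, hy, rfl⟩
      rw [hhom]
      exact ⟨⟨(t, y), ⟨⟨h1.1.le, h1.2⟩, hy⟩, rfl⟩, hin t y hy⟩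
    · exact fun h => h.elim

/-- Slice Lebesgue measure by hyperplanes parallel to the base. The slice at t is the base scaled by
t, whose (d - 1)-dimensional measure carries the factor t ^ (d - 1). -/
theorem volume_restrict_cone {a n : Space d} {h : ℝ} {S : Set (Space d)} (hSc : IsCompact S)
    (hn : ‖n‖ = 1) (hh : 0 < h) (hS : ∀ y ∈ S, ⟪n, y - a⟫_ℝ = h)
    [IsFiniteMeasure ((Measure.euclideanHausdorffMeasure (d - 1)).restrict S)] :
    volume.restrict (cone a S) = ENNReal.ofReal h •
      ((radialMeasure d).prod ((Measure.euclideanHausdorffMeasure (d - 1)).restrict S)).map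
        (fun z : ℝ × Space d => a + z.1 • (z.2 - a)) := by
  ext B hB
  have hmeas : Measurable fun z : ℝ × Space d => a + z.1 • (z.2 - a) :=
    (continuous_coneMap a).measurable
  -- Slicing along h • n instead of n makes the slice parameter equal to the cone parameter; the
  -- Jacobian h then appears as the norm of the slicing vector.
  have hn0 : h • n ≠ 0 := smul_ne_zero hh.ne' (by rw [← norm_pos_iff, hn]; exact one_pos)
  rw [Measure.restrict_apply hB, ← InnerProductSpace.euclideanHausdorffMeasure_eq_volume,
    EuclideanGeometry.euclideanHausdorffMeasure_eq_lintegral a hn0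
      (hB.inter (isCompact_cone a hSc).measurableSet), Measure.smul_apply, smul_eq_mul,
    Measure.map_apply hmeas hB, Measure.prod_apply (hmeas hB), radialMeasure,
    lintegral_withDensity_eq_lintegral_mul _ (by fun_prop)
      (measurable_measure_prodMk_left (hmeas hB)),
    ← lintegral_indicator measurableSet_Ioc]
  congr 1
  · rw [enorm_smul, ← ofReal_norm n, hn, ← ofReal_norm, Real.norm_of_nonneg hh.le]
    simp
  · refine lintegral_congr_ae ?_
    filter_upwards [Measure.ae_ne volume (0 : ℝ)] with t ht
    rw [finrank_euclideanSpace_fin, Set.inter_assoc, cone_inter_slice hn hh hS t ht]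
    by_cases h1 : t ∈ Set.Ioc (0 : ℝ) 1
    · rw [if_pos h1, Set.indicator_of_mem h1, Pi.mul_apply]
      have hpre : (Prod.mk t ⁻¹' ((fun z : ℝ × Space d => a + z.1 • (z.2 - a)) ⁻¹' B))
          = AffineMap.homothety a t ⁻¹' B := by
        ext y
        simp [AffineMap.homothety_apply, add_comm]
      have hmh : MeasurableSet (AffineMap.homothety a t ⁻¹' B) := by
        rw [← hpre]; exact measurable_prodMk_left (hmeas hB)
      rw [hpre, Measure.restrict_apply hmh, Set.inter_comm B, ← Set.image_inter_preimage,
        euclideanHausdorffMeasure_homothety_image _ _ ht, Set.inter_comm S, ENNReal.smul_def,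
        smul_eq_mul]
      congr 1
      rw [ENNReal.ofReal_pow h1.1.le, ENNReal.coe_pow]
      congr 1
      rw [← enorm_eq_nnnorm, ← ofReal_norm, Real.norm_of_nonneg h1.1.le]
    · rw [if_neg h1, Set.indicator_of_notMem h1]
      simp

/-- Integration over a cone in polar coordinates centered at the apex. -/
theorem integral_cone {a n : Space d} {h : ℝ} {S : Set (Space d)} (hSc : IsCompact S)
    (hn : ‖n‖ = 1) (hh : 0 < h) (hS : ∀ y ∈ S, ⟪n, y - a⟫_ℝ = h)
    [IsFiniteMeasure ((Measure.euclideanHausdorffMeasure (d - 1)).restrict S)]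
    {g : Space d → ℝ} (hg : Continuous g) :
    ∫ x in cone a S, g x = h * ∫ y in S, (∫ t in (0 : ℝ)..1, t ^ (d - 1) * g (a + t • (y - a)))
      ∂(Measure.euclideanHausdorffMeasure (d - 1)) := by
  have hmeas : Measurable fun z : ℝ × Space d => a + z.1 • (z.2 - a) :=
    (continuous_coneMap a).measurable
  have hint : Integrable (fun z : ℝ × Space d => g (a + z.1 • (z.2 - a)))
      ((radialMeasure d).prod ((Measure.euclideanHausdorffMeasure (d - 1)).restrict S)) := by
    have h1 : IntegrableOn g (cone a S) :=
      hg.continuousOn.integrableOn_compact (isCompact_cone a hSc)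
    rw [IntegrableOn, volume_restrict_cone hSc hn hh hS, integrable_smul_measure
      (by simpa using hh) ENNReal.ofReal_ne_top,
      integrable_map_measure hg.aestronglyMeasurable hmeas.aemeasurable] at h1
    exact h1
  rw [volume_restrict_cone hSc hn hh hS, integral_smul_measure, ENNReal.toReal_ofReal hh.le,
    smul_eq_mul, integral_map hmeas.aemeasurable hg.aestronglyMeasurable, integral_prod_symm _ hint]
  congr 2
  funext y
  rw [radialMeasure, intervalIntegral.integral_of_le zero_le_one,
    integral_withDensity_eq_integral_toReal_smul (by fun_prop) (.of_forall fun _ => by simp)]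
  refine setIntegral_congr_fun measurableSet_Ioc fun t ht => ?_
  simp only [smul_eq_mul]
  rw [ENNReal.toReal_ofReal (pow_nonneg ht.1.le _)]

/-- The divergence theorem on a cone, for a radial vector field. -/
theorem integral_cone_radial (hd : 0 < d) {a n : Space d} {h : ℝ} {S : Set (Space d)}
    (hSc : IsCompact S) (hn : ‖n‖ = 1) (hh : 0 < h) (hS : ∀ y ∈ S, ⟪n, y - a⟫_ℝ = h)
    [IsFiniteMeasure ((Measure.euclideanHausdorffMeasure (d - 1)).restrict S)]
    {f : Space d → ℝ} (hf : ContDiff ℝ 1 f) :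
    ∫ x in cone a S, (d * f x + fderiv ℝ f x (x - a)) =
      h * ∫ y in S, f y ∂(Measure.euclideanHausdorffMeasure (d - 1)) := by
  have hfd : Continuous (fderiv ℝ f) := hf.continuous_fderiv one_ne_zero
  have hcont : Continuous fun x => d * f x + fderiv ℝ f x (x - a) :=
    (continuous_const.mul hf.continuous).add (hfd.clm_apply (by fun_prop))
  rw [integral_cone hSc hn hh hS hcont]
  congr 2
  funext y
  obtain ⟨k, rfl⟩ : ∃ k, d = k + 1 := ⟨d - 1, by omega⟩
  -- On each ray the integrand is the derivative of t ^ d f(a + t (y - a)), which is 0 at the apex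
  -- (as d > 0) and f(y) on the base.
  have hder : ∀ t ∈ Set.uIcc (0 : ℝ) 1, HasDerivAt (fun t : ℝ => t ^ (k + 1) * f (a + t • (y - a)))
      (t ^ (k + 1 - 1) * (((k + 1 : ℕ) : ℝ) * f (a + t • (y - a))
        + fderiv ℝ f (a + t • (y - a)) (a + t • (y - a) - a))) t := by
    intro t _
    have h1 : HasDerivAt (fun t : ℝ => a + t • (y - a)) (y - a) t := by
      simpa using ((hasDerivAt_id t).smul_const (y - a)).const_add a
    have h2 := ((hf.differentiable one_ne_zero) (a + t • (y - a))).hasFDerivAt.comp_hasDerivAt t h1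
    have h3 := (hasDerivAt_pow (k + 1) t).mul h2
    refine h3.congr_deriv ?_
    rw [add_sub_cancel_left, map_smul, smul_eq_mul, Nat.add_sub_cancel]
    simp only [Function.comp]
    ring
  rw [intervalIntegral.integral_eq_sub_of_hasDerivAt hder
    (Continuous.intervalIntegrable ((continuous_pow _).mul (hcont.comp (by fun_prop))) _ _)]
  simp

/-! ### The geometry of a cell -/

namespace SimplicialMesh

/-- The height of the cell `K` above its face opposite to the vertex `a`. -/
def height (M : SimplicialMesh d Ω) (K : M.cells) (a : K.1) : ℝ := ‖M.altitude K a‖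

theorem coe_facet (M : SimplicialMesh d Ω) (K : M.cells) (a : K.1) :
    ((M.facet K a).1 : Set (Space d)) = (K.1 : Set (Space d)) \ {a.1} := by
  classical
  ext x
  simp [facet, and_comm]

theorem mem_facet {M : SimplicialMesh d Ω} {K : M.cells} {a : K.1} {x : Space d} :
    x ∈ (M.facet K a).1 ↔ x ∈ K.1 ∧ x ≠ a.1 := by
  rw [← Finset.mem_coe, coe_facet]
  simp

theorem facet_nonempty (M : SimplicialMesh d Ω) (hd : 0 < d) (K : M.cells) (a : K.1) :
    (M.facet K a).1.Nonempty :=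
  Finset.card_pos.1 (by rw [M.card_face]; exact hd)

theorem centroid_mem (M : SimplicialMesh d Ω) (hd : 0 < d) (K : M.cells) (a : K.1) :
    (M.facet K a).1.centroid ℝ id ∈ affineSpan ℝ ((M.facet K a).1 : Set (Space d)) := by
  have := centroid_mem_affineSpan_of_nonempty ℝ (s := (M.facet K a).1.attach)
    ((↑) : (M.facet K a).1 → Space d) (by simpa using M.facet_nonempty hd K a)
  rw [Finset.attach_eq_univ, Finset.centroid_univ] at this
  simpa using this

/-- The altitude is orthogonal to the directions of the facet, so the product does not depend on y
in its affine span; at the centroid it is the product of a vector with its own projection. -/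
theorem inner_altitude (M : SimplicialMesh d Ω) (hd : 0 < d) (K : M.cells) (a : K.1)
    {y : Space d} (hy : y ∈ affineSpan ℝ ((M.facet K a).1 : Set (Space d))) :
    ⟪M.altitude K a, y - a⟫_ℝ = -‖M.altitude K a‖ ^ 2 := by
  set W := vectorSpan ℝ ((M.facet K a).1 : Set (Space d)) with hW
  set c := (M.facet K a).1.centroid ℝ id with hc
  have halt : M.altitude K a = Wᗮ.starProjection (a.1 - c) := rfl
  have h1 : y - c ∈ W := by
    have := AffineSubspace.vsub_mem_direction hy (M.centroid_mem hd K a)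
    rwa [direction_affineSpan] at this
  have h2 : ⟪M.altitude K a, y - c⟫_ℝ = 0 := by
    rw [real_inner_comm]
    exact Submodule.inner_right_of_mem_orthogonal h1 (by
      rw [halt]; exact Submodule.starProjection_apply_mem _ _)
  have h3 : ⟪M.altitude K a, a.1 - c⟫_ℝ = ‖M.altitude K a‖ ^ 2 := by
    have h := Wᗮ.starProjection_inner_eq_zero (a.1 - c) _
      (Wᗮ.starProjection_apply_mem (a.1 - c))
    rw [inner_sub_left, sub_eq_zero, real_inner_comm] at h
    rw [halt, h, real_inner_self_eq_norm_sq]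
  have : y - a.1 = (y - c) - (a.1 - c) := by abel
  rw [this, inner_sub_right, h2, h3, zero_sub]

/-- A zero altitude would place a in the affine span of the other vertices, against affine
independence. -/
theorem height_pos (M : SimplicialMesh d Ω) (hd : 0 < d) (K : M.cells) (a : K.1) :
    0 < M.height K a := by
  refine norm_pos_iff.2 fun h0 => ?_
  set W := vectorSpan ℝ ((M.facet K a).1 : Set (Space d)) with hW
  set c := (M.facet K a).1.centroid ℝ id with hc
  have h1 : a.1 - c ∈ W := by
    have h2 : a.1 - c ∈ Wᗮᗮ := (Submodule.starProjection_apply_eq_zero_iff _).1 h0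
    rwa [Submodule.orthogonal_orthogonal] at h2
  have h3 : a.1 ∈ affineSpan ℝ ((M.facet K a).1 : Set (Space d)) := by
    have h4 := AffineSubspace.vadd_mem_of_mem_direction
      (by rw [direction_affineSpan]; exact h1) (M.centroid_mem hd K a)
    simpa [hc] using h4
  have h5 := (M.affineIndependent K.1 K.2).notMem_affineSpan_sdiff a Set.univ
  refine h5 ?_
  convert h3 using 2
  rw [coe_facet]
  ext x
  simp only [Set.mem_image, Set.mem_sdiff, Set.mem_univ, true_and, Set.mem_singleton_iff,
    Finset.mem_coe]
  constructor
  · rintro ⟨y, hy, rfl⟩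
    exact ⟨y.2, fun h => hy (Subtype.ext h)⟩
  · rintro ⟨hx, hxa⟩
    exact ⟨⟨x, hx⟩, fun h => hxa (congrArg Subtype.val h), rfl⟩

theorem norm_normal (M : SimplicialMesh d Ω) (hd : 0 < d) (K : M.cells) (a : K.1) :
    ‖M.normal K a‖ = 1 := by
  have h := (M.height_pos hd K a).ne'
  rw [height] at h
  rw [normal, norm_smul, norm_neg, norm_inv, norm_norm, inv_mul_cancel₀ h]

theorem inner_normal_of_mem_affineSpan (M : SimplicialMesh d Ω) (hd : 0 < d) (K : M.cells)
    (a : K.1) {y : Space d} (hy : y ∈ affineSpan ℝ ((M.facet K a).1 : Set (Space d))) :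
    ⟪M.normal K a, y - a⟫_ℝ = M.height K a := by
  have h := (M.height_pos hd K a).ne'
  rw [height] at h
  rw [normal, real_inner_smul_left, M.inner_altitude hd K a hy, height]
  field_simp

theorem inner_normal (M : SimplicialMesh d Ω) (hd : 0 < d) (K : M.cells)
    (a : K.1) {y : Space d} (hy : y ∈ hull (M.facet K a).1) :
    ⟪M.normal K a, y - a⟫_ℝ = M.height K a :=
  M.inner_normal_of_mem_affineSpan hd K a (convexHull_subset_affineSpan _ hy)

/-- The vertices of a cell, as an affine basis; its coordinates are the barycentric ones. -/
def cellBasis (M : SimplicialMesh d Ω) (K : M.cells) : AffineBasis K.1 ℝ (Space d) where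
  toFun := (↑)
  ind' := M.affineIndependent K.1 K.2
  tot' := (M.affineIndependent K.1 K.2).affineSpan_eq_top_iff_card_eq_finrank_add_one.2
    (by simp [M.card_eq K.1 K.2])

@[simp]
theorem cellBasis_apply (M : SimplicialMesh d Ω) (K : M.cells) (a : K.1) :
    M.cellBasis K a = a.1 := rfl

/-- Both sides are affine in y, equal to 1 at a and to 0 at the other vertices. This translates
between barycentric coordinates and normals. -/
theorem coord_eq (M : SimplicialMesh d Ω) (hd : 0 < d) (K : M.cells) (a : K.1) (y : Space d) :
    (M.cellBasis K).coord a y = 1 - ⟪M.normal K a, y - a⟫_ℝ / M.height K a := by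
  classical
  have hh := (M.height_pos hd K a).ne'
  have hs := (M.cellBasis K).sum_coord_apply_eq_one y
  have h1 : y - a.1 = ∑ b, (M.cellBasis K).coord b y • (b.1 - a.1) := by
    simp only [smul_sub, Finset.sum_sub_distrib, ← Finset.sum_smul, hs, one_smul]
    congr 1
    exact ((M.cellBasis K).linear_combination_coord_eq_self y).symm
  have h2 : ∀ b : K.1, (M.cellBasis K).coord b y * ⟪M.normal K a, b.1 - a.1⟫_ℝ
      = (if b = a then 0 else (M.cellBasis K).coord b y) * M.height K a := fun b => by
    split_ifs with hb
    · simp [hb]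
    · rw [M.inner_normal hd K a (subset_convexHull ℝ _ (mem_facet.2 ⟨b.2, fun h =>
        hb (Subtype.ext h)⟩))]
  have h3 : ⟪M.normal K a, y - a⟫_ℝ = (1 - (M.cellBasis K).coord a y) * M.height K a := by
    rw [h1, inner_sum]
    simp only [inner_smul_right, h2]
    rw [← Finset.sum_mul, ← hs]
    congr 1
    rw [eq_sub_iff_add_eq, Finset.sum_ite, Finset.sum_const_zero, zero_add,
      ← Finset.sum_filter_not_add_sum_filter (s := Finset.univ) (p := fun b => b = a)]
    congr 1
    simp [Finset.filter_eq']
  rw [h3, mul_div_cancel_right₀ _ hh]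
  ring

theorem mem_hull_iff (M : SimplicialMesh d Ω) (K : M.cells) (y : Space d) :
    y ∈ hull K.1 ↔ ∀ a, 0 ≤ (M.cellBasis K).coord a y := by
  have h := (M.cellBasis K).convexHull_eq_nonneg_coord
  have h2 : Set.range (M.cellBasis K) = (K.1 : Set (Space d)) := by
    ext x; simp
  rw [h2] at h
  rw [hull, h]
  rfl

theorem hull_eq_cone (M : SimplicialMesh d Ω) (hd : 0 < d) (K : M.cells) (a : K.1) :
    hull K.1 = cone a.1 (hull (M.facet K a).1) := by
  have h1 : (K.1 : Set (Space d)) = insert a.1 ((M.facet K a).1 : Set (Space d)) := by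
    rw [coe_facet, Set.insert_sdiff_singleton, Set.insert_eq_of_mem a.2]
  rw [hull, h1, convexHull_insert (by simpa using M.facet_nonempty hd K a)]
  ext x
  simp only [mem_convexJoin, Set.mem_singleton_iff, exists_eq_left, segment_eq_image', cone,
    Set.mem_image, Prod.exists, Set.mem_prod]
  constructor
  · rintro ⟨y, hy, t, ht, rfl⟩
    exact ⟨t, y, ⟨ht, hy⟩, rfl⟩
  · rintro ⟨t, y, ⟨ht, hy⟩, rfl⟩
    exact ⟨y, hy, t, ht, rfl⟩

/-- The divergence theorem on a cell, for a radial vector field centered at a vertex. -/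
theorem integral_cell_radial (M : SimplicialMesh d Ω) (hd : 0 < d) (K : M.cells) (a : K.1)
    {f : Space d → ℝ} (hf : ContDiff ℝ 1 f) :
    ∫ x in hull K.1, (d * f x + fderiv ℝ f x (x - a)) =
      M.height K a * ∫ y, f y ∂(M.faceMeasure (M.facet K a)) := by
  have : IsFiniteMeasure ((Measure.euclideanHausdorffMeasure (d - 1)).restrict
    (hull (M.facet K a).1)) := inferInstanceAs (IsFiniteMeasure (M.faceMeasure (M.facet K a)))
  rw [M.hull_eq_cone hd K a]
  exact integral_cone_radial hd (isCompact_hull _) (M.norm_normal hd K a) (M.height_pos hd K a)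
    (fun y hy => M.inner_normal hd K a hy) hf

/-- The divergence theorem on a cell. -/
theorem integral_cell_fderiv (M : SimplicialMesh d Ω) (hd : 0 < d) (K : M.cells)
    {f : Space d → ℝ} (hf : ContDiff ℝ 1 f) (v : Space d) :
    ∫ x in hull K.1, fderiv ℝ f x v =
      ∑ a : K.1, ⟪M.normal K a, v⟫_ℝ * ∫ y, f y ∂(M.faceMeasure (M.facet K a)) := by
  have hfd : Continuous (fderiv ℝ f) := hf.continuous_fderiv one_ne_zero
  -- β a is the linear part of the barycentric coordinate of a, applied to v. Since ∑ β a = 0 and ∑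
  -- β a • a = v, the combination ∑ β a (x - a) is the constant -v; summing the radial identities
  -- with these weights cancels every term that does not depend on the vertex.
  set β : K.1 → ℝ := fun a => (M.cellBasis K).coord a v - (M.cellBasis K).coord a 0 with hβ
  have hβn : ∀ a, ⟪M.normal K a, v⟫_ℝ = -β a * M.height K a := fun a => by
    have hh := (M.height_pos hd K a).ne'
    simp only [hβ, M.coord_eq hd, inner_sub_right, inner_zero_right]
    field_simp
    ring
  have hβ0 : ∑ a, β a = 0 := by
    simp only [hβ, Finset.sum_sub_distrib, AffineBasis.sum_coord_apply_eq_one, sub_self]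
  have hβv : ∑ a : K.1, β a • a.1 = v := by
    have h1 := (M.cellBasis K).linear_combination_coord_eq_self v
    have h2 := (M.cellBasis K).linear_combination_coord_eq_self 0
    simp only [cellBasis_apply] at h1 h2
    simp only [hβ, sub_smul, Finset.sum_sub_distrib, h1, h2, sub_zero]
  have hI : ∀ a : Space d, IntegrableOn (fun x => fderiv ℝ f x a) (hull K.1) := fun a =>
    integrableOn_cell _ (hfd.clm_apply continuous_const)
  have hA : IntegrableOn (fun x => d * f x + fderiv ℝ f x x) (hull K.1) :=
    integrableOn_cell _ ((continuous_const.mul hf.continuous).add (hfd.clm_apply continuous_id))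
  have hterm : ∀ a : K.1, ⟪M.normal K a, v⟫_ℝ * ∫ y, f y ∂(M.faceMeasure (M.facet K a)) =
      β a * (∫ x in hull K.1, fderiv ℝ f x a)
        - β a * ∫ x in hull K.1, (d * f x + fderiv ℝ f x x) := fun a => by
    rw [hβn, mul_assoc, ← M.integral_cell_radial hd K a hf]
    have h1 : ∀ x, d * f x + fderiv ℝ f x (x - a) =
        (d * f x + fderiv ℝ f x x) - fderiv ℝ f x a := fun x => by
      rw [map_sub]; ring
    simp only [h1]
    rw [integral_sub hA (hI _)]
    ring
  simp only [hterm]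
  rw [Finset.sum_sub_distrib, ← Finset.sum_mul, hβ0, zero_mul, sub_zero]
  simp only [← integral_const_mul]
  rw [← integral_finsetSum _ fun a _ => (hI a.1).const_mul (β a)]
  congr 1
  funext x
  conv_lhs => rw [← hβv]
  simp [map_sum]

end SimplicialMesh

/-! ### Cells and faces of a mesh -/

namespace SimplicialMesh

theorem coord_eq_zero_of_notMem (M : SimplicialMesh d Ω) (hd : 0 < d) (K : M.cells)
    {A : Finset (Space d)} (hA : A ⊆ K.1) (b : K.1) (hb : b.1 ∉ A) {x : Space d}
    (hx : x ∈ hull A) : (M.cellBasis K).coord b x = 0 := by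
  have hsub : A ⊆ (M.facet K b).1 := fun y hy =>
    mem_facet.2 ⟨hA hy, fun h => hb (h ▸ hy)⟩
  rw [M.coord_eq hd, M.inner_normal hd K b (convexHull_mono (Finset.coe_subset.2 hsub) hx),
    div_self (M.height_pos hd K b).ne', sub_self]

/-- Barycentric coordinates are nonnegative on the cell, so a coordinate that vanishes at an
interior point of a segment in the cell vanishes at both ends. Extremality lets vertex sets be
recovered from their hulls. -/
theorem vertex_mem_extremePoints (M : SimplicialMesh d Ω) (K : M.cells) (a : K.1) :
    a.1 ∈ (hull K.1).extremePoints ℝ := by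
  classical
  refine mem_extremePoints.2 ⟨subset_convexHull ℝ _ a.2, ?_⟩
  have key : ∀ x₁ ∈ hull K.1, ∀ x₂ ∈ hull K.1, a.1 ∈ openSegment ℝ x₁ x₂ → x₁ = a.1 := by
    rintro x₁ h₁ x₂ h₂ ⟨s, t, hs, ht, hst, hx⟩
    rw [M.mem_hull_iff] at h₁ h₂
    have hzero : ∀ b : K.1, b ≠ a → (M.cellBasis K).coord b x₁ = 0 := fun b hb => by
      have h3 : (M.cellBasis K).coord b (s • x₁ + t • x₂)
          = s * (M.cellBasis K).coord b x₁ + t * (M.cellBasis K).coord b x₂ := by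
        simpa using Convex.combo_affine_apply (f := (M.cellBasis K).coord b) (x := x₁) (y := x₂) hst
      rw [hx, ← M.cellBasis_apply, AffineBasis.coord_apply_ne _ hb] at h3
      have := mul_nonneg ht.le (h₂ b)
      nlinarith [mul_nonneg hs.le (h₁ b), mul_pos hs hs]
    refine (M.cellBasis K).ext_elem fun b => ?_
    by_cases hb : b = a
    · subst hb
      have := (M.cellBasis K).sum_coord_apply_eq_one x₁
      rw [Finset.sum_eq_single b (fun c _ hc => hzero c hc) (by simp)] at this
      rw [this, ← M.cellBasis_apply, AffineBasis.coord_apply_eq]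
    · rw [hzero b hb, ← M.cellBasis_apply, AffineBasis.coord_apply_ne _ hb]
  intro x₁ h₁ x₂ h₂ hx
  exact ⟨key x₁ h₁ x₂ h₂ hx, key x₂ h₂ x₁ h₁ (openSegment_symm ℝ x₁ x₂ ▸ hx)⟩

/-- Two distinct cells meet in a common proper face. -/
theorem exists_inter_eq (M : SimplicialMesh d Ω) {K K' : M.cells} (h : K ≠ K') :
    ∃ A : Finset (Space d), A ⊆ K.1 ∧ A ⊆ K'.1 ∧ A ≠ K.1 ∧ hull K.1 ∩ hull K'.1 = hull A := by
  obtain ⟨A, hA, hKA⟩ := M.inter_eq K.1 K.2 K'.1 K'.2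
  obtain ⟨A', hA', hKA'⟩ := M.inter_eq K'.1 K'.2 K.1 K.2
  have heq : hull A = hull A' := by rw [← hKA, ← hKA', Set.inter_comm]
  -- The mesh axiom, used in both orders, gives vertex sets of K and of K' with the same hull. A
  -- vertex of K in that hull is extreme in it, hence is one of the points of A'.
  have hsub : A ⊆ A' := fun v hv => by
    have h1 := M.vertex_mem_extremePoints K ⟨v, hA hv⟩
    have h2 : v ∈ (hull A').extremePoints ℝ := by
      refine inter_extremePoints_subset_extremePoints_of_subset ?_ ⟨?_, h1⟩
      · rw [← heq]; exact convexHull_mono (Finset.coe_subset.2 hA)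
      · rw [← heq]; exact subset_convexHull ℝ _ hv
    exact extremePoints_convexHull_subset h2
  refine ⟨A, hA, hsub.trans hA', fun hAK => h ?_, hKA⟩
  refine Subtype.ext (Finset.eq_of_subset_of_card_le (hAK ▸ hsub.trans hA') ?_)
  rw [M.card_eq K.1 K.2, M.card_eq K'.1 K'.2]

/-- No point of two distinct cells has only positive barycentric coordinates. -/
theorem exists_coord_eq_zero (M : SimplicialMesh d Ω) (hd : 0 < d) {K K' : M.cells} (h : K ≠ K') :
    ∃ b : K.1, ∀ x ∈ hull K.1 ∩ hull K'.1, (M.cellBasis K).coord b x = 0 := by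
  obtain ⟨A, hA, -, hne, hKA⟩ := M.exists_inter_eq h
  obtain ⟨b, hb, hbA⟩ := Finset.exists_of_ssubset (hA.ssubset_of_ne hne)
  exact ⟨⟨b, hb⟩, fun x hx => M.coord_eq_zero_of_notMem hd K hA ⟨b, hb⟩ hbA (hKA ▸ hx)⟩

/-- The common face omits a vertex of K, so it lies in the affine span of a facet, a proper affine
subspace. -/
theorem volume_inter_eq_zero (M : SimplicialMesh d Ω) (hd : 0 < d) {K K' : M.cells} (h : K ≠ K') :
    volume (hull K.1 ∩ hull K'.1) = 0 := by
  obtain ⟨A, hA, -, hne, hKA⟩ := M.exists_inter_eq h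
  obtain ⟨b, hb, hbA⟩ := Finset.exists_of_ssubset (hA.ssubset_of_ne hne)
  rw [hKA]
  refine measure_mono_null (convexHull_subset_affineSpan _) (Measure.addHaar_affineSubspace _ _ ?_)
  intro htop
  have hsub : A ⊆ (M.facet K ⟨b, hb⟩).1 := fun y hy =>
    mem_facet.2 ⟨hA hy, fun h => hbA (by rwa [show y = b from h] at hy)⟩
  have hmem : b ∈ affineSpan ℝ ((M.facet K ⟨b, hb⟩).1 : Set (Space d)) :=
    affineSpan_mono ℝ (Finset.coe_subset.2 hsub) (by rw [htop]; trivial)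
  have h1 := M.inner_normal_of_mem_affineSpan hd K ⟨b, hb⟩ hmem
  have h2 := M.height_pos hd K ⟨b, hb⟩
  simp at h1
  linarith

/-- A facet with a point of `Ω` in its relative interior is an interface. -/
theorem exists_interface_of_mem (M : SimplicialMesh d Ω) (hd : 0 < d) (K : M.cells) (a : K.1)
    {x : Space d} (hxF : x ∈ hull (M.facet K a).1)
    (hpos : ∀ b, b ≠ a → 0 < (M.cellBasis K).coord b x) (hxΩ : x ∈ Ω) :
    M.IsInterface (M.facet K a) := by
  classical
  -- The cells that miss x form a closed set, so all cells met close enough to x contain x.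
  set C : Set (Space d) := ⋃ K' ∈ M.cells.filter fun K' => x ∉ hull K', hull K' with hC
  have hCc : IsClosed C := isClosed_biUnion_finset fun K' _ => (isCompact_hull K').isClosed
  have hxC : x ∉ C := by simp [hC]
  have hU : (Ω : Set (Space d)) ∩ Cᶜ ∈ nhds x :=
    Filter.inter_mem (Ω.isOpen.mem_nhds hxΩ) (hCc.isOpen_compl.mem_nhds hxC)
  have hcont : Filter.Tendsto (fun ε : ℝ => x + ε • (x - a.1)) (nhdsWithin 0 (Set.Ioi 0))
      (nhds x) := by
    have h1 : Continuous fun ε : ℝ => x + ε • (x - a.1) := by fun_prop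
    have h2 := h1.tendsto 0
    simp only [zero_smul, add_zero] at h2
    exact h2.mono_left nhdsWithin_le_nhds
  -- Step slightly beyond x, away from a. The new point is outside K but still in Ω, so it lies in
  -- another cell, which must contain x too. As x has positive coordinates at all vertices of the
  -- facet, the common face of the two cells contains all of them.
  obtain ⟨ε, ⟨hyΩ, hyC⟩, hε⟩ := ((hcont.eventually hU).and self_mem_nhdsWithin).exists
  set y := x + ε • (x - a.1) with hy
  obtain ⟨K', hK', hyK'⟩ : ∃ K' ∈ M.cells, y ∈ hull K' := by
    have h3 : y ∈ ⋃ K ∈ M.cells, hull K := by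
      rw [M.iUnion_eq]; exact subset_closure hyΩ
    simpa using h3
  have hxK' : x ∈ hull K' := by
    by_contra hcon
    exact hyC (Set.mem_biUnion (by simpa using ⟨hK', hcon⟩) hyK')
  have hxK : x ∈ hull K.1 := by
    refine convexHull_mono (fun z hz => ?_) hxF
    exact (mem_facet.1 hz).1
  have hne : K ≠ ⟨K', hK'⟩ := by
    rintro rfl
    have h4 := (M.mem_hull_iff _ y).1 hyK' a
    have h5 : y - a.1 = (1 + ε) • (x - a.1) := by rw [hy, add_smul, one_smul]; abel
    rw [M.coord_eq hd, h5, inner_smul_right, M.inner_normal hd _ a hxF,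
      mul_div_cancel_right₀ _ (M.height_pos hd _ a).ne'] at h4
    have : (0 : ℝ) < ε := hε
    linarith
  obtain ⟨A, hA, hA', -, hKA⟩ := M.exists_inter_eq hne
  refine ⟨K.1, K.2, K', hK', fun h => hne (Subtype.ext h), fun b hb => (mem_facet.1 hb).1,
    fun b hb => ?_⟩
  obtain ⟨hbK, hba⟩ := mem_facet.1 hb
  refine hA' (by_contra fun hbA => ?_)
  have h6 := M.coord_eq_zero_of_notMem hd K hA ⟨b, hbK⟩ hbA (x := x)
    (by rw [← hKA]; exact ⟨hxK, hxK'⟩)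
  exact (hpos ⟨b, hbK⟩ fun h => hba (congrArg Subtype.val h)).ne' h6

/-- The barycenter of a face. -/
def barycenter (M : SimplicialMesh d Ω) (F : M.faces) : Space d := ∑ c ∈ F.1, (d : ℝ)⁻¹ • c

theorem sum_inv_card (M : SimplicialMesh d Ω) (hd : 0 < d) (F : M.faces) :
    ∑ _c ∈ F.1, (d : ℝ)⁻¹ = 1 := by
  rw [Finset.sum_const, M.card_face, nsmul_eq_mul, mul_inv_cancel₀ (by positivity)]

theorem barycenter_mem (M : SimplicialMesh d Ω) (hd : 0 < d) (F : M.faces) :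
    M.barycenter F ∈ hull F.1 :=
  (convex_convexHull ℝ _).sum_mem (fun _ _ => by positivity) (M.sum_inv_card hd F)
    fun _ hc => subset_convexHull ℝ _ hc

theorem coord_barycenter_pos (M : SimplicialMesh d Ω) (hd : 0 < d) (K : M.cells) (a b : K.1)
    (hb : b ≠ a) : 0 < (M.cellBasis K).coord b (M.barycenter (M.facet K a)) := by
  have h1 : M.barycenter (M.facet K a) - b.1 =
      ∑ c ∈ (M.facet K a).1, (d : ℝ)⁻¹ • (c - b.1) := by
    simp only [smul_sub, Finset.sum_sub_distrib, ← Finset.sum_smul, M.sum_inv_card hd, one_smul]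
    rfl
  have h2 : (M.cellBasis K).coord b (M.barycenter (M.facet K a)) =
      ∑ c ∈ (M.facet K a).1, (d : ℝ)⁻¹ * (M.cellBasis K).coord b c := by
    simp only [M.coord_eq hd, h1, inner_sum, inner_smul_right, mul_sub, Finset.sum_sub_distrib,
      mul_one, M.sum_inv_card hd, Finset.sum_div, mul_div_assoc]
  have hd' : (0 : ℝ) < (d : ℝ)⁻¹ := by positivity
  rw [h2]
  refine Finset.sum_pos' (fun c hc => mul_nonneg hd'.le ?_) ⟨b.1, mem_facet.2 ⟨b.2, fun h =>
    hb (Subtype.ext h)⟩, ?_⟩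
  · exact (M.mem_hull_iff K c).1 (subset_convexHull ℝ _ (mem_facet.1 hc).1) b
  · rw [← M.cellBasis_apply, AffineBasis.coord_apply_eq, mul_one]
    exact hd'

theorem facet_subset_hull (M : SimplicialMesh d Ω) (K : M.cells) (a : K.1) :
    hull (M.facet K a).1 ⊆ hull K.1 :=
  convexHull_mono fun _ hz => (mem_facet.1 hz).1

theorem eq_facet (M : SimplicialMesh d Ω) (F : M.faces) (K : M.cells) (h : F.1 ⊆ K.1) :
    ∃ a : K.1, M.facet K a = F := by
  classical
  have h1 : F.1 ≠ K.1 := fun h1 => by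
    have := M.card_face F
    rw [h1, M.card_eq K.1 K.2] at this
    omega
  obtain ⟨a, ha, haF⟩ := Finset.exists_of_ssubset (h.ssubset_of_ne h1)
  refine ⟨⟨a, ha⟩, Subtype.ext (Finset.eq_of_subset_of_card_le ?_ ?_).symm⟩
  · exact fun x hx => mem_facet.2 ⟨h hx, fun hxa => haF (by rwa [show x = a from hxa] at hx)⟩
  · rw [M.card_face, M.card_face]

theorem exists_facet (M : SimplicialMesh d Ω) (F : M.faces) :
    ∃ (K : M.cells) (a : K.1), M.facet K a = F := by
  classical
  obtain ⟨K, hK, hF⟩ := Finset.mem_biUnion.1 F.2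
  exact ⟨⟨K, hK⟩, M.eq_facet F ⟨K, hK⟩ (Finset.mem_powersetCard.1 hF).1⟩

/-- A continuous function which vanishes outside of `Ω` vanishes on the boundary faces. -/
theorem eq_zero_of_not_isInterface (M : SimplicialMesh d Ω) (hd : 0 < d) (F : M.faces)
    (hF : ¬ M.IsInterface F) {f : Space d → ℝ} (hf : Continuous f)
    (h0 : ∀ x, x ∉ Ω → f x = 0) : ∀ x ∈ hull F.1, f x = 0 := by
  intro x hx
  obtain ⟨K, a, rfl⟩ := M.exists_facet F
  set z := M.barycenter (M.facet K a)
  -- On the segment from x to the barycenter, all points with 0 < t < 1 are in the relative interior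
  -- of the face. They cannot be in Ω, since the face would be an interface; the value at x follows
  -- by letting t tend to 0.
  have hcont : Continuous fun t : ℝ => f ((1 - t) • x + t • z) := by fun_prop
  have hzero : ∀ t ∈ Set.Ioo (0 : ℝ) 1, f ((1 - t) • x + t • z) = 0 := fun t ht => by
    refine h0 _ fun hΩ => hF (M.exists_interface_of_mem hd K a ?_ (fun b hb => ?_) hΩ)
    · exact (convex_convexHull ℝ _) hx (M.barycenter_mem hd _) (by linarith [ht.2]) ht.1.le
        (by ring)
    · have h3 := Convex.combo_affine_apply (f := (M.cellBasis K).coord b) (x := x) (y := z)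
        (a := 1 - t) (b := t) (by ring)
      rw [h3]
      have h4 := (M.mem_hull_iff K x).1 (M.facet_subset_hull K a hx) b
      have h5 := M.coord_barycenter_pos hd K a b hb
      simp only [smul_eq_mul]
      exact add_pos_of_nonneg_of_pos (mul_nonneg (by linarith [ht.2]) h4) (mul_pos ht.1 h5)
  have hlim := (hcont.tendsto 0).mono_left (nhdsWithin_le_nhds (s := Set.Ioi 0))
  simp only [sub_zero, one_smul, zero_smul, add_zero] at hlim
  refine tendsto_nhds_unique hlim (tendsto_const_nhds.congr' ?_)
  filter_upwards [Ioo_mem_nhdsGT (zero_lt_one' ℝ)] with t ht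
  exact (hzero t ht).symm

/-- The normals of two distinct cells on a common face are opposite. -/
theorem normal_eq_neg (M : SimplicialMesh d Ω) (hd : 0 < d) {K K' : M.cells} (hKK' : K ≠ K')
    (a : K.1) (a' : K'.1) (hF : M.facet K a = M.facet K' a') :
    M.normal K' a' = -M.normal K a := by
  set z := M.barycenter (M.facet K a) with hz
  have hzF : z ∈ hull (M.facet K a).1 := M.barycenter_mem hd _
  have hzF' : z ∈ hull (M.facet K' a').1 := hF ▸ hzF
  have hh := M.height_pos hd K a
  have hh' := M.height_pos hd K' a'
  have h1 : ∀ b, b ≠ a → ⟪M.normal K' a', b.1 - z⟫_ℝ = 0 := fun b hb => by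
    have h2 : b.1 ∈ hull (M.facet K' a').1 := by
      rw [← hF]
      exact subset_convexHull ℝ _ (mem_facet.2 ⟨b.2, fun h => hb (Subtype.ext h)⟩)
    have h3 : b.1 - z = (b.1 - a'.1) - (z - a'.1) := by abel
    rw [h3, inner_sub_right, M.inner_normal hd K' a' h2, M.inner_normal hd K' a' hzF', sub_self]
  -- Expand vectors in the b - z with b a vertex of K. The normal of K' is orthogonal to those with
  -- b in the common face, so only the coordinate of a remains, and this coordinate is a multiple of
  -- the pairing with the normal of K.
  set κ := -⟪M.normal K' a', a.1 - z⟫_ℝ / M.height K a with hκ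
  have h2 : M.normal K' a' = κ • M.normal K a := by
    refine ext_inner_right ℝ fun v => ?_
    have hs := (M.cellBasis K).sum_coord_apply_eq_one (z + v)
    have hv : v = ∑ b : K.1, (M.cellBasis K).coord b (z + v) • (b.1 - z) := by
      have h4 := (M.cellBasis K).linear_combination_coord_eq_self (z + v)
      simp only [cellBasis_apply] at h4
      simp only [smul_sub, Finset.sum_sub_distrib, ← Finset.sum_smul, hs, one_smul, h4]
      abel
    have hca : (M.cellBasis K).coord a (z + v) = -⟪M.normal K a, v⟫_ℝ / M.height K a := by
      rw [M.coord_eq hd, show z + v - a.1 = (z - a.1) + v by abel, inner_add_right,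
        M.inner_normal hd K a hzF]
      field_simp
      ring
    conv_lhs => rw [hv]
    rw [inner_sum, Finset.sum_eq_single a
      (fun b _ hb => by rw [inner_smul_right, h1 b hb, mul_zero])
      (by simp), inner_smul_right, hca, real_inner_smul_left, hκ]
    ring
  have h3 : |κ| = 1 := by
    have := congrArg norm h2
    rw [norm_smul, M.norm_normal hd, M.norm_normal hd, mul_one, Real.norm_eq_abs] at this
    exact this.symm
  rcases eq_or_eq_neg_of_abs_eq h3 with h4 | h4
  · exfalso
    rw [h4, one_smul] at h2
    -- Equal normals would put a' on the same side of the face as a. Moving from the barycenter z a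
    -- little towards a' would then reach a point of K' with all barycentric coordinates in K
    -- positive, which distinct cells do not allow.
    have hpos : 0 < (M.cellBasis K).coord a a'.1 := by
      have h5 := M.inner_normal hd K' a' hzF'
      have h6 := M.inner_normal hd K a hzF
      rw [h2] at h5
      rw [M.coord_eq hd, show a'.1 - a.1 = (z - a.1) - (z - a'.1) by abel, inner_sub_right, h5, h6,
        sub_div, div_self hh.ne']
      have := div_pos hh' hh
      linarith
    have hev : ∀ b : K.1, ∀ᶠ t in nhdsWithin (0 : ℝ) (Set.Ioi 0),
        0 < (M.cellBasis K).coord b ((1 - t) • z + t • a'.1) := fun b => by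
      by_cases hb : b = a
      · subst hb
        filter_upwards [Ioo_mem_nhdsGT (zero_lt_one' ℝ)] with t ht
        rw [Convex.combo_affine_apply (f := (M.cellBasis K).coord b) (x := z) (y := a'.1)
          (a := 1 - t) (b := t) (by ring)]
        have h7 := (M.mem_hull_iff K z).1 (M.facet_subset_hull K b hzF) b
        exact add_pos_of_nonneg_of_pos (mul_nonneg (by linarith [ht.2]) h7) (mul_pos ht.1 hpos)
      · have hc : Continuous fun t : ℝ => (M.cellBasis K).coord b ((1 - t) • z + t • a'.1) :=
          (((M.cellBasis K).coord b).continuous_of_finiteDimensional).comp (by fun_prop)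
        have h8 := hc.tendsto 0
        simp only [sub_zero, one_smul, zero_smul, add_zero] at h8
        exact nhdsWithin_le_nhds (h8.eventually (lt_mem_nhds (M.coord_barycenter_pos hd K a b hb)))
    obtain ⟨t, ht, ht01⟩ := ((Filter.eventually_all.2 hev).and
      (Ioo_mem_nhdsGT (zero_lt_one' ℝ))).exists
    obtain ⟨b, hb⟩ := M.exists_coord_eq_zero hd hKK'
    refine (ht b).ne' (hb _ ⟨(M.mem_hull_iff K _).2 fun b => (ht b).le, ?_⟩)
    exact (convex_convexHull ℝ _) (M.facet_subset_hull K' a' hzF') (subset_convexHull ℝ _ a'.2)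
      (by linarith [ht01.2]) ht01.1.le (by ring)
  · rw [h2, h4, neg_smul, one_smul]

theorem facet_injective (M : SimplicialMesh d Ω) (K : M.cells) :
    Function.Injective (M.facet K) := fun a b h => by
  by_contra hab
  have h1 : a.1 ∈ (M.facet K b).1 := mem_facet.2 ⟨a.2, fun h => hab (Subtype.ext h)⟩
  rw [← h] at h1
  exact (mem_facet.1 h1).2 rfl

/-- The contributions of the two sides of the interfaces cancel. -/
theorem sum_normal_eq_zero (M : SimplicialMesh d Ω) (hd : 0 < d) (v : Space d) (G : M.faces → ℝ)
    (hG : ∀ F, ¬ M.IsInterface F → G F = 0) :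
    ∑ K : M.cells, ∑ a : K.1, ⟪M.normal K a, v⟫_ℝ * G (M.facet K a) = 0 := by
  classical
  rw [Finset.univ.sum_sigma' (fun _ => Finset.univ)
    (fun (K : M.cells) (a : K.1) => ⟪M.normal K a, v⟫_ℝ * G (M.facet K a)),
    ← Finset.sum_fiberwise _ (fun x : (K : M.cells) × K.1 => M.facet x.1 x.2)]
  refine Finset.sum_eq_zero fun F _ => ?_
  by_cases hF : M.IsInterface F
  · obtain ⟨K, hK, K', hK', hne, h1, h2⟩ := hF
    obtain ⟨a, ha⟩ := M.eq_facet F ⟨K, hK⟩ h1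
    obtain ⟨a', ha'⟩ := M.eq_facet F ⟨K', hK'⟩ h2
    have hne' : (⟨K, hK⟩ : M.cells) ≠ ⟨K', hK'⟩ := fun h => hne (congrArg Subtype.val h)
    have hfil : (Finset.univ.sigma fun _ => Finset.univ).filter
        (fun x : (K : M.cells) × K.1 => M.facet x.1 x.2 = F) =
        {⟨⟨K, hK⟩, a⟩, ⟨⟨K', hK'⟩, a'⟩} := by
      ext ⟨L, b⟩
      simp only [Finset.mem_filter, Finset.mem_sigma, Finset.mem_univ, true_and, Finset.mem_insert,
        Finset.mem_singleton]
      constructor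
      · intro hb
        by_cases hL : L = ⟨K, hK⟩
        · subst hL
          exact Or.inl (by rw [M.facet_injective _ (hb.trans ha.symm)])
        by_cases hL' : L = ⟨K', hK'⟩
        · subst hL'
          exact Or.inr (by rw [M.facet_injective _ (hb.trans ha'.symm)])
        -- A third cell on this face would have a normal opposite to two normals that are opposite
        -- to each other.
        exfalso
        have e1 := M.normal_eq_neg hd hL b a (hb.trans ha.symm)
        have e2 := M.normal_eq_neg hd hL' b a' (hb.trans ha'.symm)
        have e3 := M.normal_eq_neg hd hne' a a' (ha.trans ha'.symm)
        have e4 := M.norm_normal hd ⟨K, hK⟩ a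
        rw [e2, ← e1] at e3
        have e5 := congrArg (fun y => ⟪M.normal ⟨K, hK⟩ a, y⟫_ℝ) e3
        simp only [inner_neg_right, real_inner_self_eq_norm_sq, e4] at e5
        norm_num at e5
      · rintro (h | h)
        · cases h; exact ha
        · cases h; exact ha'
    rw [hfil, Finset.sum_pair (fun h => hne' (congrArg Sigma.fst h)), ha, ha',
      M.normal_eq_neg hd hne' a a' (ha.trans ha'.symm), inner_neg_left]
    ring
  · refine Finset.sum_eq_zero fun x hx => ?_
    rw [(Finset.mem_filter.1 hx).2, hG F hF, mul_zero]

end SimplicialMesh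

/-! ### Integration by parts with polynomials -/

theorem contDiff_polyFun (q : MvPolynomial (Fin d) ℝ) : ContDiff ℝ 1 (polyFun q) := by
  induction q using MvPolynomial.induction_on with
  | C a =>
    rw [show polyFun (MvPolynomial.C a) = fun _ : Space d => a from
      funext fun x => by simp [polyFun]]
    exact contDiff_const
  | add p q hp hq =>
    rw [show polyFun (p + q) = fun x => polyFun p x + polyFun q x from funext (polyFun_add p q)]
    exact hp.add hq
  | mul_X p i hp =>
    rw [show polyFun (p * MvPolynomial.X i) = fun x => polyFun p x * x i from
      funext fun x => by simp [polyFun]]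
    exact hp.mul (contDiff_piLp_apply 2)

theorem polyFun_mul (q r : MvPolynomial (Fin d) ℝ) (x : Space d) :
    polyFun (q * r) x = polyFun q x * polyFun r x := by simp [polyFun]

theorem fderiv_polyFun (q : MvPolynomial (Fin d) ℝ) (x v : Space d) :
    fderiv ℝ (polyFun q) x v = ⟪polyGrad q x, v⟫_ℝ := by
  have hdiff : ∀ q : MvPolynomial (Fin d) ℝ, DifferentiableAt ℝ (polyFun q) x := fun q =>
    (contDiff_polyFun q).differentiable one_ne_zero x
  induction q using MvPolynomial.induction_on with
  | C a =>
    rw [show polyFun (MvPolynomial.C a) = fun _ : Space d => a from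
      funext fun x => by simp [polyFun]]
    simp [polyGrad, polyFun, PiLp.inner_apply]
  | add p q hp hq =>
    rw [show polyFun (p + q) = fun x => polyFun p x + polyFun q x from funext (polyFun_add p q),
      fderiv_fun_add (hdiff p) (hdiff q), add_apply, hp, hq, polyGrad_add,
      inner_add_left]
  | mul_X p i hp =>
    have hX : HasFDerivAt (fun y : Space d => y i) (EuclideanSpace.proj i : Space d →L[ℝ] ℝ) x :=
      (EuclideanSpace.proj i : Space d →L[ℝ] ℝ).hasFDerivAt
    rw [show polyFun (p * MvPolynomial.X i) = fun x => polyFun p x * x i from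
      funext fun x => by simp [polyFun], ((hdiff p).hasFDerivAt.fun_mul hX).fderiv]
    have h2 : polyGrad (p * MvPolynomial.X i) x
        = polyFun p x • EuclideanSpace.single i (1 : ℝ) + x i • polyGrad p x := by
      ext j
      simp only [polyGrad, Derivation.leibniz, smul_eq_mul, polyFun_add, polyFun_mul,
        MvPolynomial.pderiv_X, PiLp.add_apply, PiLp.smul_apply]
      by_cases hij : i = j
      · subst hij; simp [polyFun]
      · simp [polyFun, hij, Ne.symm hij]
    rw [h2, inner_add_left, real_inner_smul_left, real_inner_smul_left, ← hp,
      EuclideanSpace.inner_single_left]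
    simp

namespace SimplicialMesh

/-- Integration by parts on a cell, against the gradient of a polynomial. -/
theorem integral_cell_by_parts (M : SimplicialMesh d Ω) (hd : 0 < d) (K : M.cells)
    {φ : Space d → ℝ} (hφ : ContDiff ℝ 1 φ) (q : MvPolynomial (Fin d) ℝ) :
    ∫ x in hull K.1, fderiv ℝ φ x (polyGrad q x) =
      -(∫ x in hull K.1, φ x * polyFun (polyLaplacian q) x)
        + ∑ a : K.1, ∫ x, φ x * ⟪polyGrad q x, M.normal K a⟫_ℝ ∂(M.faceMeasure (M.facet K a)) := by
  have hfd : Continuous (fderiv ℝ φ) := hφ.continuous_fderiv one_ne_zero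
  set e : Fin d → Space d := fun i => EuclideanSpace.single i 1 with he
  set g : Fin d → MvPolynomial (Fin d) ℝ := fun i => MvPolynomial.pderiv i q with hg
  have hψ : ∀ i, ContDiff ℝ 1 fun x => φ x * polyFun (g i) x := fun i =>
    hφ.mul (contDiff_polyFun _)
  -- The divergence theorem for the vector field φ ∇q, one component at a time.
  have h1 := fun i => M.integral_cell_fderiv hd K (hψ i) (e i)
  have h2 : ∀ i x, fderiv ℝ (fun x => φ x * polyFun (g i) x) x (e i)
      = φ x * polyFun (MvPolynomial.pderiv i (g i)) x + polyGrad q x i * fderiv ℝ φ x (e i) := by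
    intro i x
    rw [fderiv_fun_mul (hφ.differentiable one_ne_zero x)
      ((contDiff_polyFun _).differentiable one_ne_zero x)]
    simp only [add_apply, smul_apply, smul_eq_mul,
      fderiv_polyFun]
    congr 2
    simp [he, EuclideanSpace.inner_single_right, polyGrad]
  have h3 : ∀ x, ∑ i, fderiv ℝ (fun x => φ x * polyFun (g i) x) x (e i)
      = φ x * polyFun (polyLaplacian q) x + fderiv ℝ φ x (polyGrad q x) := by
    intro x
    simp only [h2, Finset.sum_add_distrib, ← Finset.mul_sum]
    congr 2
    · simp [polyLaplacian, polyFun, hg]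
    · conv_rhs => rw [← (EuclideanSpace.basisFun (Fin d) ℝ).sum_repr (polyGrad q x)]
      simp [map_sum, he]
  have hint : ∀ i, IntegrableOn (fun x => fderiv ℝ (fun x => φ x * polyFun (g i) x) x (e i))
      (hull K.1) := fun i =>
    integrableOn_cell _ (((hψ i).continuous_fderiv one_ne_zero).clm_apply continuous_const)
  have h4 := integral_finsetSum Finset.univ fun i _ => hint i
  simp only [h3, h1] at h4
  have h5 : ∫ x in hull K.1, (φ x * polyFun (polyLaplacian q) x + fderiv ℝ φ x (polyGrad q x)) =
      (∫ x in hull K.1, φ x * polyFun (polyLaplacian q) x)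
        + ∫ x in hull K.1, fderiv ℝ φ x (polyGrad q x) :=
    integral_add (integrableOn_cell _ (hφ.continuous.mul (continuous_polyFun _)))
      (integrableOn_cell _ (hfd.clm_apply (continuous_polyGrad q)))
  rw [h5, Finset.sum_comm] at h4
  rw [eq_neg_add_iff_add_eq, h4]
  refine Finset.sum_congr rfl fun a _ => ?_
  simp only [← integral_const_mul]
  rw [← integral_finsetSum _ fun i _ => ((memLp_face M (M.facet K a)
    (hψ i).continuous).integrable one_le_two).const_mul _]
  congr 1
  funext x
  simp only [PiLp.inner_apply, Finset.mul_sum, he]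
  refine Finset.sum_congr rfl fun i _ => ?_
  simp [polyGrad, hg]
  ring

/-- The interior of a cell lies in the interior of the closure of Ω, which is Ω by hypothesis, and
the boundary of a convex set is null. The cell itself may touch the boundary of Ω, so the inclusion
holds only almost everywhere. -/
theorem hull_ae_le (M : SimplicialMesh d Ω) (hΩ : interior (closure (Ω : Set (Space d))) = Ω)
    (K : M.cells) : hull K.1 ≤ᵐ[volume] (Ω : Set (Space d)) := by
  have h1 : interior (hull K.1) ⊆ (Ω : Set (Space d)) := by
    conv_rhs => rw [← hΩ]
    refine interior_mono ?_
    rw [← M.iUnion_eq]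
    exact Set.subset_biUnion_of_mem (u := fun K => hull K) K.2
  have h2 : volume (frontier (hull K.1)) = 0 := (convex_convexHull ℝ _).addHaar_frontier _
  refine Filter.EventuallyLE.trans ?_ (Filter.Eventually.of_forall h1 :
    (interior (hull K.1) : Set (Space d)) ≤ᵐ[volume] (Ω : Set (Space d)))
  filter_upwards [measure_eq_zero_iff_ae_notMem.1 h2] with x hx hxK
  by_contra hcon
  exact hx ⟨subset_closure hxK, hcon⟩

theorem restrict_hull_le (M : SimplicialMesh d Ω)
    (hΩ : interior (closure (Ω : Set (Space d))) = Ω) (K : M.cells) :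
    volume.restrict (hull K.1) ≤ volume.restrict (Ω : Set (Space d)) :=
  Measure.restrict_mono_ae (M.hull_ae_le hΩ K)

/-- The integral over `Ω` is the sum of the integrals over the cells. -/
theorem sum_integral_cells (M : SimplicialMesh d Ω) (hd : 0 < d)
    (hΩ : interior (closure (Ω : Set (Space d))) = Ω) {g : Space d → ℝ}
    (hg : IntegrableOn g (Ω : Set (Space d))) :
    ∑ K : M.cells, ∫ x in hull K.1, g x = ∫ x in (Ω : Set (Space d)), g x := by
  have h0 : (⋃ K : M.cells, hull K.1) ≤ᵐ[volume] (Ω : Set (Space d)) := by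
    have h2 := ae_all_iff.2 fun K => M.hull_ae_le hΩ K
    filter_upwards [h2] with x hx hxU
    obtain ⟨K, hK⟩ := Set.mem_iUnion.1 hxU
    exact hx K hK
  have h1 : (⋃ K : M.cells, hull K.1) =ᵐ[volume] (Ω : Set (Space d)) := by
    refine h0.antisymm (LE.le.eventuallyLE fun x hx => ?_)
    have h3 : x ∈ ⋃ K ∈ M.cells, hull K := by
      rw [M.iUnion_eq]; exact subset_closure hx
    obtain ⟨K, hK, hxK⟩ := Set.mem_iUnion₂.1 h3
    exact Set.mem_iUnion.2 ⟨⟨K, hK⟩, hxK⟩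
  have hg' : IntegrableOn g (⋃ K : M.cells, hull K.1) := hg.congr_set_ae h1
  have hdis : Pairwise (Function.onFun (AEDisjoint volume) fun K : M.cells => hull K.1) := by
    intro K K' h
    exact M.volume_inter_eq_zero hd h
  have hmeas : ∀ K : M.cells, NullMeasurableSet (hull K.1) volume := fun K =>
    (isCompact_hull K.1).measurableSet.nullMeasurableSet
  have hsum := hasSum_integral_iUnion_ae hmeas hdis hg'
  rw [← setIntegral_congr_set h1]
  exact (hasSum_fintype fun K : M.cells => ∫ x in hull K.1, g x).unique hsum

end SimplicialMesh

/-! ### Traces of functions in `H¹₀(Ω)` -/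

/-- Continuity of such pairings is what lets identities pass from test functions to H¹₀(Ω) by
density. -/
theorem continuous_integral_inner {α E : Type*} [MeasurableSpace α] [NormedAddCommGroup E]
    [InnerProductSpace ℝ E] {μ : Measure α} {g : α → E} (hg : MemLp g 2 μ) :
    Continuous fun u : Lp E 2 μ => ∫ x, ⟪g x, u x⟫_ℝ ∂μ := by
  have h1 : (fun u : Lp E 2 μ => ∫ x, ⟪g x, u x⟫_ℝ ∂μ) = fun u => ⟪hg.toLp g, u⟫_ℝ := by
    funext u
    rw [L2.inner_def]
    refine integral_congr_ae ?_
    filter_upwards [hg.coeFn_toLp] with x hx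
    rw [hx]
  rw [h1]
  exact continuous_const.inner continuous_id

theorem norm_sq_eq_integral {α E : Type*} [MeasurableSpace α] [NormedAddCommGroup E]
    [InnerProductSpace ℝ E] {μ : Measure α} {g : α → E} (hg : MemLp g 2 μ) :
    ‖hg.toLp g‖ ^ 2 = ∫ x, ‖g x‖ ^ 2 ∂μ := by
  rw [← real_inner_self_eq_norm_sq, L2.inner_def]
  refine integral_congr_ae ?_
  filter_upwards [hg.coeFn_toLp] with x hx
  rw [hx, real_inner_self_eq_norm_sq]

theorem denseRange_testToH10 (Ω : Opens (Space d)) : DenseRange (testToH10 Ω) := by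
  intro v
  have hv : (v : _ × _) ∈ closure (Set.range (testPair Ω)) := v.2
  rw [Metric.mem_closure_iff] at hv
  refine Metric.mem_closure_iff.2 fun ε hε => ?_
  obtain ⟨_, ⟨φ, rfl⟩, hφ⟩ := hv ε hε
  exact ⟨_, ⟨φ, rfl⟩, hφ⟩

theorem val_testToH10 (φ : 𝓓(Ω, ℝ)) :
    H10.val (testToH10 Ω φ) =ᵐ[volume.restrict (Ω : Set (Space d))] φ :=
  (memLp_test φ.continuous φ.hasCompactSupport _).coeFn_toLp

theorem grad_testToH10 (φ : 𝓓(Ω, ℝ)) :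
    H10.grad (testToH10 Ω φ) =ᵐ[volume.restrict (Ω : Set (Space d))] gradient φ :=
  (memLp_test (continuous_gradient φ) (hasCompactSupport_gradient φ) _).coeFn_toLp

theorem contDiff_test (φ : 𝓓(Ω, ℝ)) : ContDiff ℝ 1 φ := φ.contDiff.of_le (by simp)

theorem inner_gradient (φ : 𝓓(Ω, ℝ)) (x v : Space d) :
    ⟪gradient φ x, v⟫_ℝ = fderiv ℝ φ x v := by
  rw [gradient, InnerProductSpace.toDual_symm_apply]

theorem continuous_cell_integral (M : SimplicialMesh d Ω)
    (hΩ : interior (closure (Ω : Set (Space d))) = Ω) (K : M.cells) {E : Type*}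
    [NormedAddCommGroup E] [InnerProductSpace ℝ E] {g : Space d → E} (hg : Continuous g) :
    Continuous fun u : Lp E 2 (volume.restrict (Ω : Set (Space d))) =>
      ∫ x in hull K.1, ⟪g x, u x⟫_ℝ := by
  have hmeas := (isCompact_hull K.1).measurableSet
  have h1 : (volume.restrict (Ω : Set (Space d))).restrict (hull K.1)
      = volume.restrict (hull K.1) := by
    rw [Measure.restrict_restrict hmeas]
    exact Measure.restrict_congr_set ((M.hull_ae_le hΩ K).mono fun x hx =>
      propext ⟨And.left, fun h => ⟨h, hx h⟩⟩)
  have h2 : MemLp ((hull K.1).indicator g) 2 (volume.restrict (Ω : Set (Space d))) := by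
    rw [memLp_indicator_iff_restrict hmeas, h1]
    obtain ⟨C, hC⟩ := (isCompact_hull K.1).exists_bound_of_continuousOn hg.continuousOn
    have : IsFiniteMeasure (volume.restrict (hull K.1)) :=
      ⟨by rw [Measure.restrict_apply_univ]; exact (isCompact_hull K.1).measure_lt_top⟩
    exact MemLp.of_bound hg.aestronglyMeasurable C
      ((ae_restrict_iff' hmeas).2 (.of_forall hC))
  refine (continuous_integral_inner h2).congr fun u => ?_
  rw [← h1, ← integral_indicator hmeas]
  congr 1
  funext x
  by_cases hx : x ∈ hull K.1 <;> simp [hx]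

/-- The trace inequality. Apply the radial identity to φ², in a cell above F and centered at the
vertex opposite to F: the integral of φ² over F is expressed by integrals of φ² and φ ∇φ · (x - a)
over the cell. -/
theorem exists_norm_testRestrict_le (M : SimplicialMesh d Ω) (hd : 0 < d)
    (hΩ : interior (closure (Ω : Set (Space d))) = Ω) (F : M.faces) :
    ∃ C, ∀ φ : 𝓓(Ω, ℝ), ‖testRestrict M F φ‖ ≤ C * ‖testToH10 Ω φ‖ := by
  obtain ⟨K, a, rfl⟩ := M.exists_facet F
  set F := M.facet K a
  have hh := M.height_pos hd K a
  obtain ⟨R, hR⟩ := (isCompact_hull K.1).exists_bound_of_continuousOn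
    (f := fun x => x - a.1) (by fun_prop)
  -- Here d comes from the divergence of x - a, and 1 and R² from Young's inequality for 2 φ ∇φ · (x
  -- - a), with R a bound for |x - a|. Both L² norms are at most N because the product norm is a
  -- maximum.
  set B := (d + 1 + R ^ 2) / M.height K a with hB
  have hB0 : 0 ≤ B := by positivity
  refine ⟨√B, fun φ => ?_⟩
  set N := ‖testToH10 Ω φ‖ with hN
  have hφ := contDiff_test φ
  have hφc : Continuous φ := hφ.continuous
  have hfd : Continuous (fderiv ℝ φ) := hφ.continuous_fderiv one_ne_zero
  have hgc := continuous_gradient φ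
  have h1 : ∫ x in hull K.1, φ x ^ 2 ≤ N ^ 2 := by
    have h2 := norm_sq_eq_integral (memLp_test hφc φ.hasCompactSupport
      (volume.restrict (Ω : Set (Space d))))
    have h3 : ∫ x in hull K.1, φ x ^ 2 ≤ ∫ x in (Ω : Set (Space d)), φ x ^ 2 :=
      integral_mono_measure (M.restrict_hull_le hΩ K) (.of_forall fun x => sq_nonneg _)
        (memLp_test hφc φ.hasCompactSupport _).integrable_sq
    simp only [Real.norm_eq_abs, sq_abs] at h2
    rw [← h2] at h3
    refine h3.trans (pow_le_pow_left₀ (norm_nonneg _) ?_ 2)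
    exact norm_fst_le (testToH10 Ω φ).1
  have h2 : ∫ x in hull K.1, ‖gradient φ x‖ ^ 2 ≤ N ^ 2 := by
    have h2 := norm_sq_eq_integral (memLp_test hgc (hasCompactSupport_gradient φ)
      (volume.restrict (Ω : Set (Space d))))
    have h3 : ∫ x in hull K.1, ‖gradient φ x‖ ^ 2 ≤
        ∫ x in (Ω : Set (Space d)), ‖gradient φ x‖ ^ 2 :=
      integral_mono_measure (M.restrict_hull_le hΩ K) (.of_forall fun x => sq_nonneg _)
        ((memLp_test hgc (hasCompactSupport_gradient φ) _).integrable_norm_pow two_ne_zero)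
    rw [← h2] at h3
    refine h3.trans (pow_le_pow_left₀ (norm_nonneg _) ?_ 2)
    exact norm_snd_le (testToH10 Ω φ).1
  have hsq : ContDiff ℝ 1 fun x => φ x * φ x := hφ.mul hφ
  have h3 := M.integral_cell_radial hd K a hsq
  have h4 : ∫ x in hull K.1, (d * (φ x * φ x) + fderiv ℝ (fun x => φ x * φ x) x (x - a)) ≤
      ∫ x in hull K.1, ((d + 1) * φ x ^ 2 + R ^ 2 * ‖gradient φ x‖ ^ 2) := by
    refine setIntegral_mono_on (integrableOn_cell _ ?_) (integrableOn_cell _ ?_)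
      (isCompact_hull K.1).measurableSet fun x hx => ?_
    · exact (continuous_const.mul hsq.continuous).add
        ((hsq.continuous_fderiv one_ne_zero).clm_apply (by fun_prop))
    · exact (continuous_const.mul (hφc.pow 2)).add (continuous_const.mul (hgc.norm.pow 2))
    · have hdφ := hφ.differentiable one_ne_zero x
      rw [fderiv_fun_mul hdφ hdφ]
      simp only [add_apply, smul_apply, smul_eq_mul, ← inner_gradient]
      have h5 := abs_real_inner_le_norm (gradient φ x) (x - a.1)
      have h6 : ‖gradient φ x‖ * ‖x - a.1‖ ≤ ‖gradient φ x‖ * R :=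
        mul_le_mul_of_nonneg_left (hR x hx) (norm_nonneg _)
      have h7 := abs_le.1 (h5.trans h6)
      have h8 : ⟪gradient φ x, x - a.1⟫_ℝ ^ 2 ≤ (‖gradient φ x‖ * R) ^ 2 :=
        sq_le_sq' h7.1 h7.2
      nlinarith [sq_nonneg (φ x - ⟪gradient φ x, x - a.1⟫_ℝ)]
  have h5 : ∫ x in hull K.1, ((d + 1) * φ x ^ 2 + R ^ 2 * ‖gradient φ x‖ ^ 2) =
      (d + 1) * (∫ x in hull K.1, φ x ^ 2) + R ^ 2 * ∫ x in hull K.1, ‖gradient φ x‖ ^ 2 := by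
    rw [← integral_const_mul, ← integral_const_mul]
    exact integral_add (integrableOn_cell _ (continuous_const.mul (hφc.pow 2)))
      (integrableOn_cell _ (continuous_const.mul (hgc.norm.pow 2)))
  have h6 : ‖testRestrict M F φ‖ ^ 2 = ∫ x, φ x * φ x ∂(M.faceMeasure F) := by
    refine (norm_sq_eq_integral (memLp_test hφc φ.hasCompactSupport (M.faceMeasure F))).trans ?_
    simp only [Real.norm_eq_abs, pow_two, abs_mul_abs_self]
  have h7 : ‖testRestrict M F φ‖ ^ 2 ≤ B * N ^ 2 := by
    rw [h6, hB, div_mul_eq_mul_div, le_div_iff₀ hh, mul_comm, ← h3]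
    refine h4.trans ?_
    rw [h5]
    have := mul_le_mul_of_nonneg_left h2 (sq_nonneg R)
    have := mul_le_mul_of_nonneg_left h1 (by positivity : (0 : ℝ) ≤ d + 1)
    linarith
  refine le_of_sq_le_sq ?_ (by positivity)
  rwa [mul_pow, Real.sq_sqrt hB0]

/-- Density of test functions and the trace inequality are the two facts that make `extendOfNorm` a
genuine extension of the restriction to F. -/
theorem trace_testToH10 (M : SimplicialMesh d Ω) (hd : 0 < d)
    (hΩ : interior (closure (Ω : Set (Space d))) = Ω) (F : M.faces) (φ : 𝓓(Ω, ℝ)) :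
    trace M F (testToH10 Ω φ) = testRestrict M F φ :=
  LinearMap.extendOfNorm_eq (denseRange_testToH10 Ω) (exists_norm_testRestrict_le M hd hΩ F) φ

theorem coeFn_testRestrict (M : SimplicialMesh d Ω) (F : M.faces) (φ : 𝓓(Ω, ℝ)) :
    testRestrict M F φ =ᵐ[M.faceMeasure F] φ :=
  (memLp_test φ.continuous φ.hasCompactSupport _).coeFn_toLp

/-- The trace vanishes on the boundary faces. -/
theorem trace_eq_zero (M : SimplicialMesh d Ω) (hd : 0 < d)
    (hΩ : interior (closure (Ω : Set (Space d))) = Ω) (F : M.faces) (hF : ¬ M.IsInterface F)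
    (v : H10 Ω) : trace M F v = 0 := by
  have h : (trace M F : H10 Ω → _) = fun _ => 0 := by
    refine (denseRange_testToH10 Ω).equalizer (trace M F).continuous continuous_const ?_
    funext φ
    rw [Function.comp, Function.comp, trace_testToH10 M hd hΩ]
    refine Lp.ext ((coeFn_testRestrict M F φ).trans ?_)
    refine Filter.EventuallyEq.trans ?_ (Lp.coeFn_zero ℝ 2 _).symm
    refine (ae_restrict_iff' (isCompact_hull F.1).measurableSet).2 (.of_forall ?_)
    exact M.eq_zero_of_not_isInterface hd F hF φ.continuous fun x hx =>
      image_eq_zero_of_notMem_tsupport fun h => hx (φ.tsupport_subset h)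
  exact congrFun h v

/-- Integration by parts in a cell for functions in `H¹₀(Ω)`. -/
theorem integral_grad_polyGrad (M : SimplicialMesh d Ω) (hd : 0 < d)
    (hΩ : interior (closure (Ω : Set (Space d))) = Ω) (K : M.cells)
    (q : MvPolynomial (Fin d) ℝ) (v : H10 Ω) :
    ∫ x in hull K.1, ⟪polyGrad q x, H10.grad v x⟫_ℝ =
      -(∫ x in hull K.1, polyFun (polyLaplacian q) x * H10.val v x)
        + ∑ a : K.1, ∫ x, ⟪polyGrad q x, M.normal K a⟫_ℝ * trace M (M.facet K a) v x
            ∂(M.faceMeasure (M.facet K a)) := by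
  have hc1 : Continuous fun v : H10 Ω => ∫ x in hull K.1, ⟪polyGrad q x, H10.grad v x⟫_ℝ :=
    (continuous_cell_integral M hΩ K (continuous_polyGrad q)).comp
      (continuous_snd.comp continuous_subtype_val)
  have hc2 : Continuous fun v : H10 Ω =>
      ∫ x in hull K.1, polyFun (polyLaplacian q) x * H10.val v x := by
    refine ((continuous_cell_integral M hΩ K (continuous_polyFun (polyLaplacian q))).comp
      (continuous_fst.comp continuous_subtype_val)).congr fun v => ?_
    simp only [Function.comp, RCLike.inner_apply, conj_trivial, mul_comm]
    rfl
  have hc3 : ∀ a : K.1, Continuous fun v : H10 Ω =>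
      ∫ x, ⟪polyGrad q x, M.normal K a⟫_ℝ * trace M (M.facet K a) v x
        ∂(M.faceMeasure (M.facet K a)) := fun a => by
    refine ((continuous_integral_inner (memLp_face M (M.facet K a)
      ((continuous_polyGrad q).inner (continuous_const (y := M.normal K a))))).comp
      (trace M (M.facet K a)).continuous).congr fun v => ?_
    simp only [Function.comp, RCLike.inner_apply, conj_trivial, mul_comm]
  refine congrFun ((denseRange_testToH10 Ω).equalizer hc1
    (hc2.neg.add (continuous_finsetSum _ fun a _ => hc3 a)) ?_) v
  funext φ
  have hle := (Measure.absolutelyContinuous_of_le (M.restrict_hull_le hΩ K)).ae_le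
  have h := M.integral_cell_by_parts hd K (contDiff_test φ) q
  simp only [Function.comp]
  refine Eq.trans ?_ (h.trans ?_)
  · refine integral_congr_ae ?_
    filter_upwards [hle (grad_testToH10 φ)] with x hx
    rw [hx, real_inner_comm, inner_gradient]
  · congr 1
    · congr 1
      refine integral_congr_ae ?_
      filter_upwards [hle (val_testToH10 φ)] with x hx
      rw [hx, mul_comm]
    · refine Finset.sum_congr rfl fun a _ => integral_congr_ae ?_
      rw [trace_testToH10 M hd hΩ]
      filter_upwards [coeFn_testRestrict M (M.facet K a) φ] with x hx
      rw [hx, mul_comm]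

/-! ### A quasi-optimality principle in Hilbert spaces -/

section Abstract

variable {H X Y : Type*} [AddCommGroup H] [Module ℝ H]
  [NormedAddCommGroup X] [InnerProductSpace ℝ X]
  [NormedAddCommGroup Y] [InnerProductSpace ℝ Y]

/-- The bilinear form `(s, σ) ↦ ⟪G s, G σ⟫ + ⟪T s, T σ⟫`. -/
def energyForm (G : H →ₗ[ℝ] X) (T : H →ₗ[ℝ] Y) : H →ₗ[ℝ] H →ₗ[ℝ] ℝ :=
  (innerₗ X).compl₁₂ G G + (innerₗ Y).compl₁₂ T T

theorem energyForm_apply (G : H →ₗ[ℝ] X) (T : H →ₗ[ℝ] Y) (s σ : H) :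
    energyForm G T s σ = ⟪G s, G σ⟫_ℝ + ⟪T s, T σ⟫_ℝ := rfl

theorem existsUnique_energyForm [FiniteDimensional ℝ H] {G : H →ₗ[ℝ] X} {T : H →ₗ[ℝ] Y}
    (hdef : ∀ s, G s = 0 → T s = 0 → s = 0) (l : H →ₗ[ℝ] ℝ) :
    ∃! U, ∀ σ, ⟪G U, G σ⟫_ℝ + ⟪T U, T σ⟫_ℝ = l σ := by
  have hB : ∀ v, energyForm G T v v = 0 → v = 0 := fun v hv => by
    rw [energyForm_apply] at hv
    have h1 := real_inner_self_nonneg (x := G v)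
    have h2 := real_inner_self_nonneg (x := T v)
    exact hdef v (inner_self_eq_zero (𝕜 := ℝ).1 (by linarith))
      (inner_self_eq_zero (𝕜 := ℝ).1 (by linarith))
  obtain ⟨U, hU⟩ := exists_representer (energyForm G T) hB l
  refine ⟨U, hU, fun U' hU' => ?_⟩
  have h : ∀ w, energyForm G T U' w = l w := hU'
  refine sub_eq_zero.1 (hB _ ?_)
  rw [map_sub (energyForm G T), LinearMap.sub_apply, h, hU, sub_self]

/-- Definiteness makes s ↦ (G s, T s) injective, so P factors through its finite-dimensional range
and is bounded there. The admissible constants form a closed nonempty set bounded below, which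
contains its infimum. -/
theorem exists_isLeast_bound [FiniteDimensional ℝ H] {G : H →ₗ[ℝ] X} {T : H →ₗ[ℝ] Y}
    (hdef : ∀ s, G s = 0 → T s = 0 → s = 0) (P : H →ₗ[ℝ] X) :
    ∃ C, IsLeast {c : ℝ | 0 ≤ c ∧ ∀ σ, ‖P σ‖ ≤ c * √(‖G σ‖ ^ 2 + ‖T σ‖ ^ 2)} C := by
  have hinj : Function.Injective (G.prod T) := by
    rw [← LinearMap.ker_eq_bot, LinearMap.ker_eq_bot']
    intro s hs
    exact hdef s (congrArg Prod.fst hs) (congrArg Prod.snd hs)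
  let e := LinearEquiv.ofInjective (G.prod T) hinj
  let Q : LinearMap.range (G.prod T) →L[ℝ] X :=
    LinearMap.toContinuousLinearMap (P ∘ₗ e.symm.toLinearMap)
  have hQ : ∀ σ, ‖P σ‖ ≤ ‖Q‖ * √(‖G σ‖ ^ 2 + ‖T σ‖ ^ 2) := fun σ => by
    have h1 : Q (e σ) = P σ := by simp [Q]
    rw [← h1]
    refine (Q.le_opNorm _).trans (mul_le_mul_of_nonneg_left ?_ (norm_nonneg _))
    change ‖(G σ, T σ)‖ ≤ _
    -- The norm on the product is the maximum, which the Euclidean combination dominates.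
    refine max_le (Real.le_sqrt_of_sq_le ?_) (Real.le_sqrt_of_sq_le ?_)
    · exact le_add_of_nonneg_right (sq_nonneg _)
    · exact le_add_of_nonneg_left (sq_nonneg _)
  have hclosed : IsClosed {c : ℝ | 0 ≤ c ∧ ∀ σ, ‖P σ‖ ≤ c * √(‖G σ‖ ^ 2 + ‖T σ‖ ^ 2)} := by
    have h2 : {c : ℝ | 0 ≤ c ∧ ∀ σ, ‖P σ‖ ≤ c * √(‖G σ‖ ^ 2 + ‖T σ‖ ^ 2)} =
        Set.Ici 0 ∩ ⋂ σ, {c : ℝ | ‖P σ‖ ≤ c * √(‖G σ‖ ^ 2 + ‖T σ‖ ^ 2)} := by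
      ext c; simp
    rw [h2]
    exact isClosed_Ici.inter
      (isClosed_iInter fun σ => isClosed_le continuous_const (by fun_prop))
  exact ⟨_, hclosed.isLeast_csInf ⟨‖Q‖, Q.opNorm_nonneg, hQ⟩ ⟨0, fun c hc => hc.1⟩⟩

/-- The discrete solution differs from the best approximation only by the consistency error of
replacing G σ by P σ in the load. By `horth` this error sees only x - G s₀, and it is orthogonal to
the best error in the Pythagorean splitting. -/
theorem quasiOptimality [FiniteDimensional ℝ H] {G : H →ₗ[ℝ] X} {T : H →ₗ[ℝ] Y}
    {P : H → X} (hdef : ∀ s, G s = 0 → T s = 0 → s = 0)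
    (horth : ∀ τ σ, ⟪G τ, P σ⟫_ℝ = ⟪G τ, G σ⟫_ℝ) {C : ℝ} (hC : 0 ≤ C)
    (hCb : ∀ σ, ‖G σ - P σ‖ ≤ C * √(‖G σ‖ ^ 2 + ‖T σ‖ ^ 2)) {x : X} {U : H}
    (hU : ∀ σ, ⟪G U, G σ⟫_ℝ + ⟪T U, T σ⟫_ℝ = ⟪x, P σ⟫_ℝ) :
    √(‖x - G U‖ ^ 2 + ‖T U‖ ^ 2)
      ≤ √(1 + C ^ 2) * ⨅ s : H, √(‖x - G s‖ ^ 2 + ‖T s‖ ^ 2) := by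
  -- s₀ is the minimizer of ‖x - G s‖² + ‖T s‖²: its normal equations have the load ⟪x, G σ⟫.
  obtain ⟨s₀, hs₀, -⟩ := existsUnique_energyForm hdef ((innerₗ X (x)) ∘ₗ G)
  simp only [LinearMap.comp_apply, innerₗ_apply_apply] at hs₀
  have hpyth : ∀ s, ‖x - G s‖ ^ 2 + ‖T s‖ ^ 2 =
      (‖x - G s₀‖ ^ 2 + ‖T s₀‖ ^ 2) + (‖G (s - s₀)‖ ^ 2 + ‖T (s - s₀)‖ ^ 2) := fun s => by
    have h1 := hs₀ (s - s₀)
    have h2 : x - G s = (x - G s₀) - G (s - s₀) := by rw [map_sub]; abel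
    have h3 : T s = T s₀ + T (s - s₀) := by rw [map_sub]; abel
    rw [h2, h3, norm_sub_sq_real, norm_add_sq_real, inner_sub_left]
    linarith
  set A := ‖x - G s₀‖ ^ 2 + ‖T s₀‖ ^ 2 with hA
  have hA0 : 0 ≤ A := by positivity
  set σ := U - s₀ with hσ
  set N := ‖G σ‖ ^ 2 + ‖T σ‖ ^ 2 with hN
  have hN0 : 0 ≤ N := by positivity
  have h1 : N = ⟪x - G s₀, P σ - G σ⟫_ℝ := by
    have h2 := hU σ
    have h3 := hs₀ σ
    rw [hN, ← real_inner_self_eq_norm_sq, ← real_inner_self_eq_norm_sq, inner_sub_left,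
      inner_sub_right, inner_sub_right, horth, ← h2, ← h3, hσ, map_sub G U, map_sub T U]
    simp only [inner_sub_left]
    ring
  have h2 : N ≤ √A * (C * √N) := by
    conv_lhs => rw [h1]
    refine (real_inner_le_norm _ _).trans (mul_le_mul ?_ ?_ (norm_nonneg _) (Real.sqrt_nonneg _))
    · exact Real.le_sqrt_of_sq_le (le_add_of_nonneg_right (sq_nonneg _))
    · rw [norm_sub_rev]; exact hCb σ
  have h3 : √N ≤ C * √A := by
    -- A factor √N is cancelled, so N = 0 is treated apart.
    rcases hN0.eq_or_lt with h0 | h0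
    · rw [← h0, Real.sqrt_zero]; positivity
    · refine le_of_mul_le_mul_right ?_ (Real.sqrt_pos.2 h0)
      rw [Real.mul_self_sqrt hN0]
      linarith
  have h4 : N ≤ C ^ 2 * A := by
    have := pow_le_pow_left₀ (Real.sqrt_nonneg N) h3 2
    rwa [mul_pow, Real.sq_sqrt hN0, Real.sq_sqrt hA0] at this
  have h5 : √A ≤ ⨅ s : H, √(‖x - G s‖ ^ 2 + ‖T s‖ ^ 2) :=
    le_ciInf fun s => Real.sqrt_le_sqrt (by
      rw [hpyth s]; exact le_add_of_nonneg_right (by positivity))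
  refine le_trans ?_ (mul_le_mul_of_nonneg_left h5 (Real.sqrt_nonneg _))
  rw [← Real.sqrt_mul (by positivity), hpyth U]
  refine Real.sqrt_le_sqrt ?_
  linarith

end Abstract

/-! ### Linearity of the discrete operators -/

theorem pderiv_mem_Poly {n : ℕ} {q : MvPolynomial (Fin d) ℝ} (hq : q ∈ Poly d (n + 1))
    (i : Fin d) : MvPolynomial.pderiv i q ∈ Poly d n := by
  rw [MvPolynomial.mem_restrictTotalDegree] at hq ⊢
  refine Finset.sup_le fun m hm => ?_
  rw [MvPolynomial.mem_support_iff, MvPolynomial.coeff_pderiv] at hm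
  have h1 := (MvPolynomial.le_totalDegree
    (MvPolynomial.mem_support_iff.2 (left_ne_zero_of_mul hm))).trans hq
  rw [Finsupp.sum_add_index' (by simp) (by simp), Finsupp.sum_single_index rfl] at h1
  omega

/-- Makes Δq an admissible cell moment. For p = 0 no polynomial satisfies the strict degree bound,
not even 0, but then q is affine and Δq = 0. -/
theorem polyLaplacian_eq_zero_or {p : ℕ} {q : MvPolynomial (Fin d) ℝ} (hq : q ∈ Poly d (p + 1)) :
    polyLaplacian q = 0 ∨ (polyLaplacian q).totalDegree < p := by
  rcases p with _ | p
  · left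
    refine Finset.sum_eq_zero fun i _ => ?_
    have h1 := pderiv_mem_Poly hq i
    rw [MvPolynomial.mem_restrictTotalDegree, Nat.le_zero,
      MvPolynomial.totalDegree_eq_zero_iff_eq_C] at h1
    rw [h1, MvPolynomial.pderiv_C]
  · right
    have h1 : polyLaplacian q ∈ Poly d p :=
      Submodule.sum_mem _ fun i _ => pderiv_mem_Poly (pderiv_mem_Poly hq i) i
    rw [MvPolynomial.mem_restrictTotalDegree] at h1
    omega

/-- The normals are constant on faces, so ∇q · n_K loses one degree and is an admissible face
moment. -/
theorem exists_polyFun_eq_inner_polyGrad {p : ℕ} {q : MvPolynomial (Fin d) ℝ}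
    (hq : q ∈ Poly d (p + 1)) (v : Space d) :
    ∃ r ∈ Poly d p, ∀ x, polyFun r x = ⟪polyGrad q x, v⟫_ℝ := by
  refine ⟨∑ i, v i • MvPolynomial.pderiv i q,
    Submodule.sum_mem _ fun i _ => Submodule.smul_mem _ _ (pderiv_mem_Poly hq i), fun x => ?_⟩
  simp [polyFun, polyGrad, PiLp.inner_apply]

theorem polyFun_C (c : ℝ) (x : Space d) : polyFun (MvPolynomial.C c) x = c := by simp [polyFun]

theorem polyGrad_C (c : ℝ) (x : Space d) : polyGrad (MvPolynomial.C c) x = 0 := by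
  ext i; simp [polyGrad, polyFun]

variable {M : SimplicialMesh d Ω} {p : ℕ}

theorem eq_C_of_integral_polyGrad_eq_zero (K : M.cells) {q : MvPolynomial (Fin d) ℝ}
    (h : ∫ x in hull K.1, ⟪polyGrad q x, polyGrad q x⟫_ℝ = 0) :
    q = MvPolynomial.C (MvPolynomial.coeff 0 q) := by
  have h3 := eq_zero_of_integral_eq_zero M K ((continuous_polyGrad q).inner (continuous_polyGrad q))
    (fun x => real_inner_self_nonneg) h
  refine eq_C_of_pderiv_eq_zero fun i =>
    eq_zero_of_eqOn_open isOpen_interior (M.interior_nonempty K) fun x hx => ?_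
  have h5 : polyGrad q x = 0 := inner_self_eq_zero.1 (h3 x hx)
  simpa [polyGrad] using congrArg (fun y : Space d => y i) h5

theorem integral_hull_one_ne_zero (K : M.cells) : (∫ _ in hull K.1, (1 : ℝ)) ≠ 0 := fun h => by
  obtain ⟨x, hx⟩ := M.interior_nonempty K
  exact one_ne_zero (eq_zero_of_integral_eq_zero M K (f := fun _ => (1 : ℝ)) continuous_const
    (fun _ => zero_le_one) h x hx)

theorem reconstruction_mem (s : M.HybridSpace p) (K : M.cells) :
    reconstruction s K ∈ Poly d (p + 1) :=
  (exists_reconstruction s K).choose.2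

theorem integral_polyGrad_reconstruction (s : M.HybridSpace p) (K : M.cells)
    {q : MvPolynomial (Fin d) ℝ} (hq : q ∈ Poly d (p + 1)) :
    ∫ x in hull K.1, ⟪polyGrad (reconstruction s K) x, polyGrad q x⟫_ℝ
      = reconstructionRhs s K q :=
  (exists_reconstruction s K).choose_spec.1 q hq

theorem integral_reconstruction (s : M.HybridSpace p) (K : M.cells) :
    ∫ x in hull K.1, polyFun (reconstruction s K) x = ∫ x in hull K.1, polyFun (cellPart s K) x :=
  (exists_reconstruction s K).choose_spec.2

theorem integral_polyGrad_sub (K : M.cells) (q r t : MvPolynomial (Fin d) ℝ) :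
    ∫ x in hull K.1, ⟪polyGrad (q - r) x, polyGrad t x⟫_ℝ =
      (∫ x in hull K.1, ⟪polyGrad q x, polyGrad t x⟫_ℝ)
        - ∫ x in hull K.1, ⟪polyGrad r x, polyGrad t x⟫_ℝ := by
  have h : ∀ x, polyGrad (q - r) x = polyGrad q x - polyGrad r x := fun x => by
    rw [sub_eq_add_neg, ← neg_one_smul ℝ r, polyGrad_add, polyGrad_smul, neg_one_smul,
      sub_eq_add_neg]
  simp only [h, inner_sub_left]
  exact integral_sub (integrableOn_cell _ ((continuous_polyGrad q).inner (continuous_polyGrad t)))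
    (integrableOn_cell _ ((continuous_polyGrad r).inner (continuous_polyGrad t)))

/-- The difference of two candidates has zero gradient, hence is constant, and has zero mean. As
`reconstruction` is obtained by choice, its linearity has to come from this uniqueness. -/
theorem eq_reconstruction (s : M.HybridSpace p) (K : M.cells) {r : MvPolynomial (Fin d) ℝ}
    (hr : r ∈ Poly d (p + 1))
    (h1 : ∀ q ∈ Poly d (p + 1),
      ∫ x in hull K.1, ⟪polyGrad r x, polyGrad q x⟫_ℝ = reconstructionRhs s K q)
    (h2 : ∫ x in hull K.1, polyFun r x = ∫ x in hull K.1, polyFun (cellPart s K) x) :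
    r = reconstruction s K := by
  set t := r - reconstruction s K with ht
  have htm : t ∈ Poly d (p + 1) := Submodule.sub_mem _ hr (reconstruction_mem s K)
  have h3 := eq_C_of_integral_polyGrad_eq_zero K (q := t) (by
    conv_lhs => rw [ht]
    rw [integral_polyGrad_sub, h1 _ htm, integral_polyGrad_reconstruction s K htm, sub_self])
  have h4 : ∫ x in hull K.1, polyFun t x = 0 := by
    have h : ∀ x, polyFun t x = polyFun r x - polyFun (reconstruction s K) x := fun x => by
      simp [ht, polyFun]
    simp only [h]
    rw [integral_sub (integrableOn_cell _ (continuous_polyFun _))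
      (integrableOn_cell _ (continuous_polyFun _)), h2, integral_reconstruction, sub_self]
  rw [h3] at h4
  simp only [polyFun_C] at h4
  rw [show (fun _ : Space d => MvPolynomial.coeff 0 t) = fun _ => MvPolynomial.coeff 0 t * 1 by
    simp, integral_const_mul] at h4
  rw [(mul_eq_zero.1 h4).resolve_right (integral_hull_one_ne_zero K), MvPolynomial.C_0] at h3
  exact sub_eq_zero.1 h3

theorem cellPart_add (s σ : M.HybridSpace p) (K : M.cells) :
    cellPart (s + σ) K = cellPart s K + cellPart σ K := rfl

theorem cellPart_smul (c : ℝ) (s : M.HybridSpace p) (K : M.cells) :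
    cellPart (c • s) K = c • cellPart s K := rfl

theorem facePart_add (s σ : M.HybridSpace p) (F : M.faces) :
    facePart (s + σ) F = facePart s F + facePart σ F := rfl

theorem facePart_smul (c : ℝ) (s : M.HybridSpace p) (F : M.faces) :
    facePart (c • s) F = c • facePart s F := rfl

theorem reconstructionRhs_add (s σ : M.HybridSpace p) (K : M.cells)
    (q : MvPolynomial (Fin d) ℝ) :
    reconstructionRhs (s + σ) K q = reconstructionRhs s K q + reconstructionRhs σ K q := by
  have h1 : ∫ x in hull K.1, polyFun (cellPart (s + σ) K) x * polyFun (polyLaplacian q) x =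
      (∫ x in hull K.1, polyFun (cellPart s K) x * polyFun (polyLaplacian q) x)
        + ∫ x in hull K.1, polyFun (cellPart σ K) x * polyFun (polyLaplacian q) x := by
    simp only [cellPart_add, polyFun_add, add_mul]
    exact integral_add
      (integrableOn_cell _ ((continuous_polyFun _).mul (continuous_polyFun _)))
      (integrableOn_cell _ ((continuous_polyFun _).mul (continuous_polyFun _)))
  have h2 : ∀ a : K.1, ∫ x, facePart (s + σ) (M.facet K a) x * ⟪polyGrad q x, M.normal K a⟫_ℝ
        ∂(M.faceMeasure (M.facet K a)) =
      (∫ x, facePart s (M.facet K a) x * ⟪polyGrad q x, M.normal K a⟫_ℝ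
        ∂(M.faceMeasure (M.facet K a))) +
      ∫ x, facePart σ (M.facet K a) x * ⟪polyGrad q x, M.normal K a⟫_ℝ
        ∂(M.faceMeasure (M.facet K a)) := fun a => by
    have hc : Continuous fun x => ⟪polyGrad q x, M.normal K a⟫_ℝ :=
      (continuous_polyGrad q).inner continuous_const
    rw [← integral_add (integrable_facePart_mul s _ hc) (integrable_facePart_mul σ _ hc),
      facePart_add]
    refine integral_congr_ae ?_
    filter_upwards [Lp.coeFn_add (facePart s (M.facet K a)) (facePart σ (M.facet K a))] with x hx
    rw [hx, Pi.add_apply, add_mul]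
  simp only [reconstructionRhs, h1, h2, Finset.sum_add_distrib]
  ring

theorem reconstructionRhs_smul (c : ℝ) (s : M.HybridSpace p) (K : M.cells)
    (q : MvPolynomial (Fin d) ℝ) :
    reconstructionRhs (c • s) K q = c * reconstructionRhs s K q := by
  have h2 : ∀ a : K.1, ∫ x, facePart (c • s) (M.facet K a) x * ⟪polyGrad q x, M.normal K a⟫_ℝ
        ∂(M.faceMeasure (M.facet K a)) =
      c * ∫ x, facePart s (M.facet K a) x * ⟪polyGrad q x, M.normal K a⟫_ℝ
        ∂(M.faceMeasure (M.facet K a)) := fun a => by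
    rw [← integral_const_mul, facePart_smul]
    refine integral_congr_ae ?_
    filter_upwards [Lp.coeFn_smul c (facePart s (M.facet K a))] with x hx
    rw [hx, Pi.smul_apply, smul_eq_mul, mul_assoc]
  simp only [reconstructionRhs, h2, cellPart_smul, polyFun_smul, mul_assoc, integral_const_mul,
    ← Finset.mul_sum]
  ring

/-- The reconstruction in the cell `K`, as a linear map. -/
def reconstructionₗ (M : SimplicialMesh d Ω) (p : ℕ) (K : M.cells) :
    M.HybridSpace p →ₗ[ℝ] MvPolynomial (Fin d) ℝ where
  toFun s := reconstruction s K
  map_add' s σ := by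
    refine (eq_reconstruction _ K (Submodule.add_mem _ (reconstruction_mem s K)
      (reconstruction_mem σ K)) (fun q hq => ?_) ?_).symm
    · simp only [polyGrad_add, inner_add_left]
      rw [reconstructionRhs_add, ← integral_polyGrad_reconstruction s K hq,
        ← integral_polyGrad_reconstruction σ K hq]
      exact integral_add
        (integrableOn_cell _ ((continuous_polyGrad _).inner (continuous_polyGrad _)))
        (integrableOn_cell _ ((continuous_polyGrad _).inner (continuous_polyGrad _)))
    · simp only [cellPart_add, polyFun_add]
      rw [integral_add (integrableOn_cell _ (continuous_polyFun _))
          (integrableOn_cell _ (continuous_polyFun _)),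
        integral_add (integrableOn_cell _ (continuous_polyFun _))
          (integrableOn_cell _ (continuous_polyFun _)),
        integral_reconstruction, integral_reconstruction]
  map_smul' c s := by
    refine (eq_reconstruction _ K (Submodule.smul_mem _ c (reconstruction_mem s K))
      (fun q hq => ?_) ?_).symm
    · simp only [polyGrad_smul, real_inner_smul_left]
      rw [reconstructionRhs_smul, ← integral_polyGrad_reconstruction s K hq, integral_const_mul]
    · simp only [cellPart_smul, polyFun_smul]
      rw [integral_const_mul, integral_const_mul, integral_reconstruction]

theorem integrableOn_polyFun_mul (K : M.cells) (q r : MvPolynomial (Fin d) ℝ) :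
    IntegrableOn (fun x => polyFun q x * polyFun r x) (hull K.1) :=
  integrableOn_cell _ ((continuous_polyFun q).mul (continuous_polyFun r))

theorem integral_mul_cellProj (n : ℕ) (K : M.cells) (r : MvPolynomial (Fin d) ℝ)
    {q : MvPolynomial (Fin d) ℝ} (hq : q ∈ Poly d n) :
    ∫ x in hull K.1, polyFun q x * polyFun (cellProj M n K r) x
      = ∫ x in hull K.1, polyFun q x * polyFun r x :=
  (exists_cellProjection M n K r).choose_spec q hq

/-- The difference of two candidates is orthogonal to itself. Again uniqueness yields linearity of a
chosen object. -/
theorem eq_cellProj (n : ℕ) (K : M.cells) (r : MvPolynomial (Fin d) ℝ)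
    {π : MvPolynomial (Fin d) ℝ} (hπ : π ∈ Poly d n)
    (h : ∀ q ∈ Poly d n, ∫ x in hull K.1, polyFun q x * polyFun π x
      = ∫ x in hull K.1, polyFun q x * polyFun r x) : π = cellProj M n K r := by
  set t := π - cellProj M n K r with ht
  have htm : t ∈ Poly d n := Submodule.sub_mem _ hπ (exists_cellProjection M n K r).choose.2
  have h1 : ∫ x in hull K.1, polyFun t x * polyFun t x = 0 := by
    have h2 : ∀ x, polyFun t x * polyFun t x =
        polyFun t x * polyFun π x - polyFun t x * polyFun (cellProj M n K r) x := fun x => by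
      rw [← mul_sub]; simp [ht, polyFun]
    simp only [h2]
    rw [integral_sub (integrableOn_polyFun_mul K _ _)
      (integrableOn_polyFun_mul K _ _), h t htm,
      integral_mul_cellProj n K r htm, sub_self]
  exact sub_eq_zero.1 (eq_zero_of_eqOn_open isOpen_interior (M.interior_nonempty K) fun x hx =>
    mul_self_eq_zero.1 (eq_zero_of_integral_eq_zero M K
      ((continuous_polyFun t).mul (continuous_polyFun t)) (fun x => mul_self_nonneg _) h1 x hx))

/-- The `L²(K)`-projection, as a linear map. -/
def cellProjₗ (M : SimplicialMesh d Ω) (n : ℕ) (K : M.cells) :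
    MvPolynomial (Fin d) ℝ →ₗ[ℝ] MvPolynomial (Fin d) ℝ where
  toFun := cellProj M n K
  map_add' r t := by
    refine (eq_cellProj n K _ (Submodule.add_mem _ (exists_cellProjection M n K r).choose.2
      (exists_cellProjection M n K t).choose.2) fun q hq => ?_).symm
    change ∫ x in hull K.1, polyFun q x * polyFun (cellProj M n K r + cellProj M n K t) x = _
    simp only [polyFun_add, mul_add]
    rw [integral_add (integrableOn_polyFun_mul K _ _)
        (integrableOn_polyFun_mul K _ _),
      integral_add (integrableOn_polyFun_mul K _ _)
        (integrableOn_polyFun_mul K _ _),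
      integral_mul_cellProj n K r hq, integral_mul_cellProj n K t hq]
  map_smul' c r := by
    refine (eq_cellProj n K _ (Submodule.smul_mem _ c (exists_cellProjection M n K r).choose.2)
      fun q hq => ?_).symm
    change ∫ x in hull K.1, polyFun q x * polyFun (c • cellProj M n K r) x = _
    simp only [polyFun_smul, mul_left_comm _ c]
    rw [integral_const_mul, integral_const_mul, integral_mul_cellProj n K r hq]

/-- The cell component, as a linear map. -/
def cellPartₗ (M : SimplicialMesh d Ω) (p : ℕ) (K : M.cells) :
    M.HybridSpace p →ₗ[ℝ] MvPolynomial (Fin d) ℝ where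
  toFun s := cellPart s K
  map_add' _ _ := rfl
  map_smul' _ _ := rfl

/-- The face component, as a linear map. -/
def facePartₗ (M : SimplicialMesh d Ω) (p : ℕ) (F : M.faces) :
    M.HybridSpace p →ₗ[ℝ] Lp ℝ 2 (M.faceMeasure F) where
  toFun s := facePart s F
  map_add' _ _ := rfl
  map_smul' _ _ := rfl

/-- The stabilization operator in the cell `K`, as a linear map. -/
def stabOperatorₗ (M : SimplicialMesh d Ω) (p : ℕ) (K : M.cells) :
    M.HybridSpace p →ₗ[ℝ] MvPolynomial (Fin d) ℝ :=
  cellPartₗ M p K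
    + (reconstructionₗ M p K - cellProjₗ M p K ∘ₗ reconstructionₗ M p K)

/-- The residual on a face of the cell `K`, as a linear map. -/
def faceResidualₗ (M : SimplicialMesh d Ω) (p : ℕ) (K : M.cells) (a : K.1) :
    M.HybridSpace p →ₗ[ℝ] Lp ℝ 2 (M.faceMeasure (M.facet K a)) :=
  ((M.FacePoly p (M.facet K a)).starProjection : Lp ℝ 2 _ →ₗ[ℝ] Lp ℝ 2 _) ∘ₗ
    (facePartₗ M p (M.facet K a) - M.faceRestrict (M.facet K a) ∘ₗ stabOperatorₗ M p K)

/-! ### The discrete operators with values in Hilbert spaces -/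

instance (A : Finset (Space d)) : IsFiniteMeasure (volume.restrict (hull A)) :=
  ⟨by rw [Measure.restrict_apply_univ]; exact (isCompact_hull A).measure_lt_top⟩

theorem memLp_cell (A : Finset (Space d)) {f : Space d → Space d} (hf : Continuous f) :
    MemLp f 2 (volume.restrict (hull A)) := by
  obtain ⟨C, hC⟩ := (isCompact_hull A).exists_bound_of_continuousOn hf.continuousOn
  exact MemLp.of_bound hf.aestronglyMeasurable C
    ((ae_restrict_iff' (isCompact_hull A).measurableSet).2 (.of_forall hC))

theorem inner_toLp {α F : Type*} [MeasurableSpace α] [NormedAddCommGroup F]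
    [InnerProductSpace ℝ F] {μ : Measure α} {f g : α → F} (hf : MemLp f 2 μ) (hg : MemLp g 2 μ) :
    ⟪hf.toLp f, hg.toLp g⟫_ℝ = ∫ x, ⟪f x, g x⟫_ℝ ∂μ := by
  rw [L2.inner_def]
  refine integral_congr_ae ?_
  filter_upwards [hf.coeFn_toLp, hg.coeFn_toLp] with x h1 h2
  rw [h1, h2]

/-- The gradient of a polynomial, as an element of `L²(K)^d`. -/
def polyGradₗ (A : Finset (Space d)) :
    MvPolynomial (Fin d) ℝ →ₗ[ℝ] Lp (Space d) 2 (volume.restrict (hull A)) where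
  toFun q := (memLp_cell A (continuous_polyGrad q)).toLp
  map_add' q r := by
    rw [← MemLp.toLp_add]
    exact MemLp.toLp_congr _ _ (.of_forall fun x => polyGrad_add q r x)
  map_smul' c q := by
    rw [RingHom.id_apply, ← MemLp.toLp_const_smul]
    exact MemLp.toLp_congr _ _ (.of_forall fun x => polyGrad_smul c q x)

/-- The restriction of square integrable functions to a smaller measure. -/
def restrictLp {α F : Type*} [MeasurableSpace α] [NormedAddCommGroup F] [NormedSpace ℝ F]
    {μ ν : Measure α} (h : μ ≤ ν) : Lp F 2 ν →ₗ[ℝ] Lp F 2 μ where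
  toFun u := ((Lp.memLp u).mono_measure h).toLp
  map_add' u v := by
    rw [← MemLp.toLp_add]
    exact MemLp.toLp_congr _ _ ((Measure.absolutelyContinuous_of_le h).ae_le (Lp.coeFn_add u v))
  map_smul' c u := by
    rw [RingHom.id_apply, ← MemLp.toLp_const_smul]
    exact MemLp.toLp_congr _ _ ((Measure.absolutelyContinuous_of_le h).ae_le (Lp.coeFn_smul c u))

/-- The square integrable vector fields, cell by cell. -/
def CellFields (M : SimplicialMesh d Ω) : Type :=
  PiLp 2 fun K : M.cells => Lp (Space d) 2 (volume.restrict (hull K.1))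

instance (M : SimplicialMesh d Ω) : NormedAddCommGroup (CellFields M) :=
  inferInstanceAs (NormedAddCommGroup (PiLp 2 fun K : M.cells =>
    Lp (Space d) 2 (volume.restrict (hull K.1))))

instance (M : SimplicialMesh d Ω) : InnerProductSpace ℝ (CellFields M) :=
  inferInstanceAs (InnerProductSpace ℝ (PiLp 2 fun K : M.cells =>
    Lp (Space d) 2 (volume.restrict (hull K.1))))

/-- The restriction to the cell `K` of a square integrable vector field. -/
def CellFields.restrict {M : SimplicialMesh d Ω} (g : CellFields M) (K : M.cells) :
    Lp (Space d) 2 (volume.restrict (hull K.1)) :=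
  WithLp.ofLp (p := 2) g K

/-- The square integrable vector field with given restrictions to the cells. -/
def CellFields.pi (M : SimplicialMesh d Ω) {W : Type*} [AddCommMonoid W] [Module ℝ W]
    (g : ∀ K : M.cells, W →ₗ[ℝ] Lp (Space d) 2 (volume.restrict (hull K.1))) :
    W →ₗ[ℝ] CellFields M where
  toFun s := WithLp.toLp 2 fun K => g K s
  map_add' s σ := by simp only [map_add]; rfl
  map_smul' c s := by simp only [map_smul]; rfl

theorem CellFields.inner_eq {M : SimplicialMesh d Ω} (f g : CellFields M) :
    ⟪f, g⟫_ℝ = ∑ K, ⟪f.restrict K, g.restrict K⟫_ℝ :=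
  PiLp.inner_apply (𝕜 := ℝ) _ _

/-- The square integrable functions on the faces of the cells. -/
def FaceFields (M : SimplicialMesh d Ω) : Type :=
  PiLp 2 fun x : (K : M.cells) × K.1 => Lp ℝ 2 (M.faceMeasure (M.facet x.1 x.2))

instance (M : SimplicialMesh d Ω) : NormedAddCommGroup (FaceFields M) :=
  inferInstanceAs (NormedAddCommGroup (PiLp 2 fun x : (K : M.cells) × K.1 =>
    Lp ℝ 2 (M.faceMeasure (M.facet x.1 x.2))))

instance (M : SimplicialMesh d Ω) : InnerProductSpace ℝ (FaceFields M) :=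
  inferInstanceAs (InnerProductSpace ℝ (PiLp 2 fun x : (K : M.cells) × K.1 =>
    Lp ℝ 2 (M.faceMeasure (M.facet x.1 x.2))))

/-- The restriction of a square integrable function to a face. -/
def FaceFields.restrict {M : SimplicialMesh d Ω} (g : FaceFields M) (K : M.cells) (a : K.1) :
    Lp ℝ 2 (M.faceMeasure (M.facet K a)) :=
  WithLp.ofLp (p := 2) g ⟨K, a⟩

theorem FaceFields.inner_eq {M : SimplicialMesh d Ω} (f g : FaceFields M) :
    ⟪f, g⟫_ℝ = ∑ K, ∑ a, ⟪f.restrict K a, g.restrict K a⟫_ℝ := by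
  refine (PiLp.inner_apply (𝕜 := ℝ) _ _).trans ?_
  rw [← Finset.univ_sigma_univ, Finset.sum_sigma]
  rfl

/-- The cell-wise gradient of the reconstruction. -/
def discreteGrad (M : SimplicialMesh d Ω) (p : ℕ) : M.HybridSpace p →ₗ[ℝ] CellFields M :=
  CellFields.pi M fun K => polyGradₗ K.1 ∘ₗ reconstructionₗ M p K

/-- The cell-wise gradient of a function in `H¹₀(Ω)`. -/
def brokenGrad (M : SimplicialMesh d Ω) (hΩ : interior (closure (Ω : Set (Space d))) = Ω) :
    H10 Ω →ₗ[ℝ] CellFields M :=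
  CellFields.pi M fun K => restrictLp (M.restrict_hull_le hΩ K) ∘ₗ
    LinearMap.snd ℝ _ _ ∘ₗ (H10 Ω).subtype

/-- The weighted face residuals. -/
def weightedResidual (M : SimplicialMesh d Ω) (p : ℕ) (w : M.faces → ℝ) :
    M.HybridSpace p →ₗ[ℝ] FaceFields M where
  toFun s := WithLp.toLp 2 fun x => √(w (M.facet x.1 x.2)) • faceResidualₗ M p x.1 x.2 s
  map_add' s σ := by simp only [map_add, smul_add]; rfl
  map_smul' c s := by simp only [map_smul, smul_comm _ c]; rfl

/-- Each weight is split as √w √w between the two arguments, which turns the stabilization into a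
Gram form. -/
theorem stab_eq_inner {w : M.faces → ℝ} (hw : ∀ F, 0 < w F) (s σ : M.HybridSpace p) :
    stab w s σ = ⟪weightedResidual M p w s, weightedResidual M p w σ⟫_ℝ := by
  rw [FaceFields.inner_eq, stab]
  refine Finset.sum_congr rfl fun K _ => Finset.sum_congr rfl fun a _ => ?_
  change _ = ⟪√(w (M.facet K a)) • faceResidual s K a, √(w (M.facet K a)) • faceResidual σ K a⟫_ℝ
  rw [real_inner_smul_left, real_inner_smul_right, ← mul_assoc, Real.mul_self_sqrt (hw _).le,
    L2.inner_def]
  congr 2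
  funext x
  simp [mul_comm]

theorem field_eq_toLp (hΩ : interior (closure (Ω : Set (Space d))) = Ω) (v : H10 Ω)
    (s : M.HybridSpace p) (K : M.cells) :
    ∃ h : MemLp (fun x => H10.grad v x + polyGrad (reconstruction s K) x) 2
      (volume.restrict (hull K.1)),
      (brokenGrad M hΩ v + discreteGrad M p s).restrict K = h.toLp := by
  have h1 : MemLp (H10.grad v) 2 (volume.restrict (hull K.1)) :=
    (Lp.memLp v.1.2).mono_measure (M.restrict_hull_le hΩ K)
  have h2 := memLp_cell K.1 (continuous_polyGrad (reconstruction s K))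
  exact ⟨h1.add h2, (MemLp.toLp_add h1 h2).symm⟩

theorem inner_fields (hΩ : interior (closure (Ω : Set (Space d))) = Ω) (v : H10 Ω)
    (s : M.HybridSpace p) (v' : H10 Ω) (σ : M.HybridSpace p) :
    ⟪brokenGrad M hΩ v + discreteGrad M p s, brokenGrad M hΩ v' + discreteGrad M p σ⟫_ℝ =
      ∑ K : M.cells, ∫ x in hull K.1, ⟪H10.grad v x + polyGrad (reconstruction s K) x,
        H10.grad v' x + polyGrad (reconstruction σ K) x⟫_ℝ := by
  rw [CellFields.inner_eq]
  refine Finset.sum_congr rfl fun K _ => ?_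
  obtain ⟨h1, e1⟩ := field_eq_toLp hΩ v s K
  obtain ⟨h2, e2⟩ := field_eq_toLp hΩ v' σ K
  rw [e1, e2, inner_toLp]

theorem extendedForm_eq_inner (hΩ : interior (closure (Ω : Set (Space d))) = Ω) {w : M.faces → ℝ}
    (hw : ∀ F, 0 < w F) (v : H10 Ω) (s : M.HybridSpace p) (v' : H10 Ω) (σ : M.HybridSpace p) :
    extendedForm w v s v' σ =
      ⟪brokenGrad M hΩ v + discreteGrad M p s, brokenGrad M hΩ v' + discreteGrad M p σ⟫_ℝ
        + ⟪weightedResidual M p w s, weightedResidual M p w σ⟫_ℝ := by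
  rw [extendedForm, stab_eq_inner hw, inner_fields]

theorem inner_discreteGrad (s σ : M.HybridSpace p) :
    ⟪discreteGrad M p s, discreteGrad M p σ⟫_ℝ = ∑ K : M.cells, ∫ x in hull K.1,
      ⟪polyGrad (reconstruction s K) x, polyGrad (reconstruction σ K) x⟫_ℝ := by
  rw [CellFields.inner_eq]
  exact Finset.sum_congr rfl fun K _ => inner_toLp (memLp_cell K.1 (continuous_polyGrad _))
    (memLp_cell K.1 (continuous_polyGrad _))

theorem discreteForm_eq_inner {w : M.faces → ℝ} (hw : ∀ F, 0 < w F) (s σ : M.HybridSpace p) :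
    discreteForm w s σ = ⟪discreteGrad M p s, discreteGrad M p σ⟫_ℝ
      + ⟪weightedResidual M p w s, weightedResidual M p w σ⟫_ℝ := by
  rw [discreteForm, stab_eq_inner hw, inner_discreteGrad]

theorem extendedNorm_eq (hΩ : interior (closure (Ω : Set (Space d))) = Ω) {w : M.faces → ℝ}
    (hw : ∀ F, 0 < w F) (v : H10 Ω) (s : M.HybridSpace p) :
    extendedNorm w v s =
      √(‖brokenGrad M hΩ v + discreteGrad M p s‖ ^ 2 + ‖weightedResidual M p w s‖ ^ 2) := by
  rw [extendedNorm, extendedForm_eq_inner hΩ hw, real_inner_self_eq_norm_sq,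
    real_inner_self_eq_norm_sq]

theorem smoothingError_eq (hΩ : interior (closure (Ω : Set (Space d))) = Ω)
    (E : M.HybridSpace p →ₗ[ℝ] H10 Ω) (σ : M.HybridSpace p) :
    smoothingError E σ = ‖discreteGrad M p σ - brokenGrad M hΩ (E σ)‖ := by
  rw [← Real.sqrt_sq (norm_nonneg (discreteGrad M p σ - brokenGrad M hΩ (E σ))), smoothingError,
    ← real_inner_self_eq_norm_sq, CellFields.inner_eq]
  congr 1
  refine Finset.sum_congr rfl fun K _ => ?_
  have h1 : MemLp (H10.grad (E σ)) 2 (volume.restrict (hull K.1)) :=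
    (Lp.memLp (E σ).1.2).mono_measure (M.restrict_hull_le hΩ K)
  have h2 := memLp_cell K.1 (continuous_polyGrad (reconstruction σ K))
  have h3 : (discreteGrad M p σ - brokenGrad M hΩ (E σ)).restrict K = (h2.sub h1).toLp :=
    (MemLp.toLp_sub h2 h1).symm
  rw [h3, inner_toLp]
  simp only [Pi.sub_apply, real_inner_self_eq_norm_sq]

/-- The cells tile Ω up to null sets. This identifies the Poisson form with the inner product of the
abstract argument. -/
theorem inner_brokenGrad (hd : 0 < d) (hΩ : interior (closure (Ω : Set (Space d))) = Ω)
    (u v : H10 Ω) : ⟪brokenGrad M hΩ u, brokenGrad M hΩ v⟫_ℝ =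
      ∫ x in (Ω : Set (Space d)), ⟪H10.grad u x, H10.grad v x⟫_ℝ := by
  have hint : IntegrableOn (fun x => ⟪H10.grad u x, H10.grad v x⟫_ℝ) (Ω : Set (Space d)) :=
    L2.integrable_inner u.1.2 v.1.2
  rw [← M.sum_integral_cells hd hΩ hint, CellFields.inner_eq]
  exact Finset.sum_congr rfl fun K _ =>
    inner_toLp ((Lp.memLp u.1.2).mono_measure (M.restrict_hull_le hΩ K))
      ((Lp.memLp v.1.2).mono_measure (M.restrict_hull_le hΩ K))

/-- On interfaces this is moment preservation. On boundary faces, where no moment is prescribed, the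
trace of E σ and the face component of σ both vanish. -/
theorem integral_face_moment (hd : 0 < d) (hΩ : interior (closure (Ω : Set (Space d))) = Ω)
    {E : M.HybridSpace p →ₗ[ℝ] H10 Ω} (hE : PreservesMoments E) (σ : M.HybridSpace p)
    (F : M.faces) {q : MvPolynomial (Fin d) ℝ} (hq : q ∈ Poly d (p + 1)) (v : Space d) :
    ∫ x, ⟪polyGrad q x, v⟫_ℝ * trace M F (E σ) x ∂(M.faceMeasure F) =
      ∫ x, facePart σ F x * ⟪polyGrad q x, v⟫_ℝ ∂(M.faceMeasure F) := by
  obtain ⟨r, hr, hrx⟩ := exists_polyFun_eq_inner_polyGrad hq v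
  simp only [← hrx]
  refine Eq.trans ?_ (integral_congr_ae (.of_forall fun x => mul_comm _ _))
  by_cases hF : M.IsInterface F
  · exact (hE σ).2 F hF r hr
  · have h1 : facePart σ F = 0 := congrArg Subtype.val (σ.2 F hF)
    rw [trace_eq_zero M hd hΩ F hF, h1]

/-- A smoother which preserves moments has the same gradient moments as the reconstruction. -/
theorem inner_discreteGrad_brokenGrad (hd : 0 < d)
    (hΩ : interior (closure (Ω : Set (Space d))) = Ω) {E : M.HybridSpace p →ₗ[ℝ] H10 Ω}
    (hE : PreservesMoments E) (τ σ : M.HybridSpace p) :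
    ⟪discreteGrad M p τ, brokenGrad M hΩ (E σ)⟫_ℝ
      = ⟪discreteGrad M p τ, discreteGrad M p σ⟫_ℝ := by
  rw [inner_discreteGrad, CellFields.inner_eq]
  refine Finset.sum_congr rfl fun K _ => ?_
  set q := reconstruction τ K with hq
  have hqm : q ∈ Poly d (p + 1) := reconstruction_mem τ K
  refine (inner_toLp (memLp_cell K.1 (continuous_polyGrad q))
    ((Lp.memLp (E σ).1.2).mono_measure (M.restrict_hull_le hΩ K))).trans ?_
  -- After integration by parts only moments of E σ against Δq and ∇q · n_K are left; they are
  -- compared term by term with the right-hand side defining R σ.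
  refine (integral_grad_polyGrad M hd hΩ K q (E σ)).trans ?_
  simp_rw [real_inner_comm (polyGrad (reconstruction σ K) _)]
  rw [integral_polyGrad_reconstruction σ K hqm, reconstructionRhs]
  congr 1
  · congr 1
    simp only [mul_comm (polyFun (cellPart σ K) _)]
    rcases polyLaplacian_eq_zero_or hqm with h0 | h0
    · simp [h0, polyFun]
    · exact (hE σ).1 K _ h0
  · refine Finset.sum_congr rfl fun a _ => ?_
    exact integral_face_moment hd hΩ hE σ _ hqm _

/-! ### Definiteness of the discrete form -/

theorem cellProj_eq_self (K : M.cells) {q : MvPolynomial (Fin d) ℝ} (hq : q ∈ Poly d p) :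
    cellProj M p K q = q :=
  (eq_cellProj p K q hq fun _ _ => rfl).symm

theorem C_mem_Poly (n : ℕ) (c : ℝ) : (MvPolynomial.C c : MvPolynomial (Fin d) ℝ) ∈ Poly d n := by
  simp [MvPolynomial.mem_restrictTotalDegree]

theorem reconstruction_eq_C {s : M.HybridSpace p} (hG : discreteGrad M p s = 0) (K : M.cells) :
    reconstruction s K = MvPolynomial.C (MvPolynomial.coeff 0 (reconstruction s K)) := by
  refine eq_C_of_integral_polyGrad_eq_zero K ?_
  have h1 : polyGradₗ K.1 (reconstruction s K) = 0 :=
    congrArg (fun g : CellFields M => g.restrict K) hG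
  have h2 := inner_toLp (memLp_cell K.1 (continuous_polyGrad (reconstruction s K)))
    (memLp_cell K.1 (continuous_polyGrad (reconstruction s K)))
  rw [← h2]
  change ⟪polyGradₗ K.1 (reconstruction s K), _⟫_ℝ = 0
  rw [h1, inner_zero_left]

/-- R s is constant on the cell, so Π_K fixes it and S s = s_K. The difference s_F - s_K is already
a polynomial of degree at most p on F, so Π_F loses nothing, and a positive weight can be divided
out. -/
theorem facePart_eq {w : M.faces → ℝ} (hw : ∀ F, 0 < w F) {s : M.HybridSpace p}
    (hG : discreteGrad M p s = 0) (hT : weightedResidual M p w s = 0) (K : M.cells) (a : K.1) :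
    facePart s (M.facet K a) = M.faceRestrict (M.facet K a) (cellPart s K) := by
  have h1 : √(w (M.facet K a)) • faceResidual s K a = 0 :=
    congrArg (fun g : FaceFields M => g.restrict K a) hT
  have h2 : faceResidual s K a = 0 :=
    (smul_eq_zero.1 h1).resolve_left (Real.sqrt_pos.2 (hw _)).ne'
  have h3 : stabOperator s K = cellPart s K := by
    have h4 := cellProj_eq_self (p := p) K
      (C_mem_Poly p (MvPolynomial.coeff 0 (reconstruction s K)))
    rw [← reconstruction_eq_C hG K] at h4
    rw [stabOperator, h4, sub_self, add_zero]
  have h5 : facePart s (M.facet K a) - M.faceRestrict (M.facet K a) (cellPart s K)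
      ∈ M.FacePoly p (M.facet K a) :=
    Submodule.sub_mem _ (s.1.2 (M.facet K a)).2 (Submodule.mem_map_of_mem (s.1.1 K).2)
  rw [faceResidual, faceProj, h3, Submodule.starProjection_eq_self_iff.2 h5] at h2
  exact sub_eq_zero.1 h2

theorem coeFn_faceRestrict (M : SimplicialMesh d Ω) (F : M.faces) (q : MvPolynomial (Fin d) ℝ) :
    M.faceRestrict F q =ᵐ[M.faceMeasure F] polyFun q :=
  (memLp_face M F (continuous_polyFun q)).coeFn_toLp

/-- Test the reconstruction equation with q = s_K, admissible since p ≤ p + 1. As s_F = s_K on the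
faces, its right-hand side is ∫ |∇s_K|² by integration by parts, and its left-hand side is 0 because
R s is constant. -/
theorem cellPart_eq_C (hd : 0 < d) {w : M.faces → ℝ} (hw : ∀ F, 0 < w F) {s : M.HybridSpace p}
    (hG : discreteGrad M p s = 0) (hT : weightedResidual M p w s = 0) (K : M.cells) :
    cellPart s K = MvPolynomial.C (MvPolynomial.coeff 0 (cellPart s K)) := by
  set q := cellPart s K with hq
  have hqm : q ∈ Poly d (p + 1) := by
    have h1 : q ∈ Poly d p := (s.1.1 K).2
    rw [MvPolynomial.mem_restrictTotalDegree] at h1 ⊢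
    omega
  refine eq_C_of_integral_polyGrad_eq_zero K ?_
  have h2 := integral_polyGrad_reconstruction s K hqm
  have h3 := M.integral_cell_by_parts hd K (contDiff_polyFun q) q
  simp only [fderiv_polyFun] at h3
  rw [h3]
  rw [reconstruction_eq_C hG K] at h2
  simp only [polyGrad_C, inner_zero_left, integral_zero] at h2
  rw [h2, reconstructionRhs]
  congr 1
  refine Finset.sum_congr rfl fun a _ => integral_congr_ae ?_
  rw [facePart_eq hw hG hT K a]
  filter_upwards [coeFn_faceRestrict M (M.facet K a) (cellPart s K)] with x hx
  rw [hx]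

theorem eq_zero_of_energy_eq_zero (hd : 0 < d) {w : M.faces → ℝ} (hw : ∀ F, 0 < w F)
    (s : M.HybridSpace p) (hG : discreteGrad M p s = 0) (hT : weightedResidual M p w s = 0) :
    s = 0 := by
  set c : M.cells → ℝ := fun K => MvPolynomial.coeff 0 (cellPart s K) with hc
  have hcell : ∀ K, cellPart s K = MvPolynomial.C (c K) := fun K => cellPart_eq_C hd hw hG hT K
  set i : Fin d := ⟨0, hd⟩
  set e : Space d := EuclideanSpace.single i 1 with he
  -- The flux potential of the field s² x_i e_i on F. It depends on the face alone, not on the cell,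
  -- because s_F is single-valued; hence the two sides of an interface cancel.
  set G : M.faces → ℝ := fun F => ∫ x, facePart s F x ^ 2 * x i ∂(M.faceMeasure F) with hGdef
  have hG0 : ∀ F, ¬ M.IsInterface F → G F = 0 := fun F hF => by
    have h1 : facePart s F = 0 := congrArg Subtype.val (s.2 F hF)
    simp only [hGdef, h1]
    rw [← integral_zero (Space d) ℝ (μ := M.faceMeasure F)]
    refine integral_congr_ae ?_
    filter_upwards [Lp.coeFn_zero ℝ 2 (M.faceMeasure F)] with x hx
    rw [hx]
    simp
  have hK : ∀ K : M.cells, c K ^ 2 * (∫ _ in hull K.1, (1 : ℝ)) =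
      ∑ a : K.1, ⟪M.normal K a, e⟫_ℝ * G (M.facet K a) := fun K => by
    -- The derivative of c_K² x_i in direction e_i is the constant c_K², so the volume of the cell
    -- appears on the left.
    have h1 := M.integral_cell_fderiv hd K
      (contDiff_polyFun (MvPolynomial.C (c K ^ 2) * MvPolynomial.X i)) e
    have h2 : ∀ x, fderiv ℝ (polyFun (MvPolynomial.C (c K ^ 2) * MvPolynomial.X i)) x e =
        c K ^ 2 := by
      intro x
      rw [fderiv_polyFun, he, EuclideanSpace.inner_single_right]
      simp [polyGrad, polyFun]
    simp only [h2] at h1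
    rw [show (fun _ : Space d => c K ^ 2) = fun _ => c K ^ 2 * 1 by simp, integral_const_mul] at h1
    rw [h1]
    refine Finset.sum_congr rfl fun a _ => ?_
    congr 1
    refine integral_congr_ae ?_
    rw [facePart_eq hw hG hT K a]
    filter_upwards [coeFn_faceRestrict M (M.facet K a) (cellPart s K)] with x hx
    rw [hx, hcell, polyFun_C]
    simp [polyFun]
  have hsum : ∑ K : M.cells, c K ^ 2 * (∫ _ in hull K.1, (1 : ℝ)) = 0 := by
    simp only [hK]
    exact M.sum_normal_eq_zero hd e G hG0
  have hc0 : ∀ K, c K = 0 := fun K => by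
    have h1 := (Finset.sum_eq_zero_iff_of_nonneg fun K _ => mul_nonneg (sq_nonneg (c K))
      (integral_nonneg fun _ => zero_le_one)).1 hsum K (Finset.mem_univ K)
    exact pow_eq_zero_iff two_ne_zero |>.1
      ((mul_eq_zero.1 h1).resolve_right (integral_hull_one_ne_zero K))
  have hcell0 : ∀ K, cellPart s K = 0 := fun K => by rw [hcell, hc0, MvPolynomial.C_0]
  refine Subtype.ext (Prod.ext (funext fun K => Subtype.ext (hcell0 K)) (funext fun F => ?_))
  obtain ⟨K, a, rfl⟩ := M.exists_facet F
  refine Subtype.ext ?_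
  change facePart s (M.facet K a) = 0
  rw [facePart_eq hw hG hT K a, hcell0, map_zero]

/-! ### The modified problem -/

/-- An error û - ŝ is encoded as the pair (u, -s); this brings its semi-norm into the form used by
`quasiOptimality`. -/
theorem extendedNorm_neg (hΩ : interior (closure (Ω : Set (Space d))) = Ω) {w : M.faces → ℝ}
    (hw : ∀ F, 0 < w F) (u : H10 Ω) (s : M.HybridSpace p) :
    extendedNorm w u (-s) =
      √(‖brokenGrad M hΩ u - discreteGrad M p s‖ ^ 2 + ‖weightedResidual M p w s‖ ^ 2) := by
  have h1 : brokenGrad M hΩ u + discreteGrad M p (-s) = brokenGrad M hΩ u - discreteGrad M p s := by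
    rw [(discreteGrad M p).map_neg s]
    exact (sub_eq_add_neg _ _).symm
  have h2 : ‖weightedResidual M p w (-s)‖ = ‖weightedResidual M p w s‖ := by
    rw [(weightedResidual M p w).map_neg s]
    exact norm_neg _
  rw [extendedNorm_eq hΩ hw, h1, h2]

theorem extendedNorm_zero (hΩ : interior (closure (Ω : Set (Space d))) = Ω) {w : M.faces → ℝ}
    (hw : ∀ F, 0 < w F) (s : M.HybridSpace p) :
    extendedNorm w 0 s = √(‖discreteGrad M p s‖ ^ 2 + ‖weightedResidual M p w s‖ ^ 2) := by
  rw [extendedNorm_eq hΩ hw, (brokenGrad M hΩ).map_zero, zero_add]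

theorem existsUnique_discreteSolution (hd : 0 < d) {w : M.faces → ℝ} (hw : ∀ F, 0 < w F)
    (E : M.HybridSpace p →ₗ[ℝ] H10 Ω) (f : StrongDual ℝ (H10 Ω)) :
    ∃! U, IsDiscreteSolution w E f U := by
  have h := existsUnique_energyForm (H := M.HybridSpace p) (eq_zero_of_energy_eq_zero hd hw)
    ((f : H10 Ω →ₗ[ℝ] ℝ) ∘ₗ E)
  simp only [← discreteForm_eq_inner hw] at h
  exact h

theorem exists_isLeast_smoothing (hd : 0 < d) (hΩ : interior (closure (Ω : Set (Space d))) = Ω)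
    {w : M.faces → ℝ} (hw : ∀ F, 0 < w F) (E : M.HybridSpace p →ₗ[ℝ] H10 Ω) :
    ∃ C : ℝ, IsLeast {c : ℝ | 0 ≤ c ∧ ∀ σ : M.HybridSpace p,
      smoothingError E σ ≤ c * extendedNorm w 0 σ} C := by
  have h := exists_isLeast_bound (H := M.HybridSpace p) (eq_zero_of_energy_eq_zero hd hw)
    (discreteGrad M p - brokenGrad M hΩ ∘ₗ E)
  simp only [smoothingError_eq hΩ, extendedNorm_zero hΩ hw]
  exact h

theorem extendedNorm_sub_discreteSolution_le (hd : 0 < d)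
    (hΩ : interior (closure (Ω : Set (Space d))) = Ω) {w : M.faces → ℝ} (hw : ∀ F, 0 < w F)
    {E : M.HybridSpace p →ₗ[ℝ] H10 Ω} (hE : PreservesMoments E) {C : ℝ} (hC : 0 ≤ C)
    (hCb : ∀ σ : M.HybridSpace p, smoothingError E σ ≤ C * extendedNorm w 0 σ)
    {f : StrongDual ℝ (H10 Ω)} {u : H10 Ω} {U : M.HybridSpace p} (hu : IsPoissonSolution f u)
    (hU : IsDiscreteSolution w E f U) :
    extendedNorm w u (-U) ≤ √(1 + C ^ 2) * ⨅ s : M.HybridSpace p, extendedNorm w u (-s) := by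
  simp only [smoothingError_eq hΩ, extendedNorm_zero hΩ hw] at hCb
  simp only [extendedNorm_neg hΩ hw]
  have key := quasiOptimality (H := M.HybridSpace p) (G := discreteGrad M p)
    (T := weightedResidual M p w) (P := fun σ => brokenGrad M hΩ (E σ))
    (eq_zero_of_energy_eq_zero hd hw)
  refine key (inner_discreteGrad_brokenGrad hd hΩ hE) hC hCb fun σ => ?_
  -- Testing the Poisson equation with E σ replaces the load by ⟪∇u, ∇(E σ)⟫, which makes the
  -- discrete equation an equation about ∇u.
  rw [← discreteForm_eq_inner hw, inner_brokenGrad hd hΩ, hu]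
  exact hU σ

end HHO

end

theorem mainTheorem2 {d : ℕ} (hd : d = 2 ∨ d = 3) (Ω : TopologicalSpace.Opens (HHO.Space d))
    (hΩ : interior (closure (Ω : Set (HHO.Space d))) = Ω)
    (M : HHO.SimplicialMesh d Ω) (p : ℕ)
    (w : M.faces → ℝ) (hw : ∀ F, 0 < w F)
    (E : M.HybridSpace p →ₗ[ℝ] HHO.H10 Ω) (hE : HHO.PreservesMoments E) :
    (∀ f : StrongDual ℝ (HHO.H10 Ω), ∃! U, HHO.IsDiscreteSolution w E f U) ∧
    ∃ C : ℝ,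
      IsLeast {c : ℝ | 0 ≤ c ∧ ∀ σ : M.HybridSpace p,
        HHO.smoothingError E σ ≤ c * HHO.extendedNorm w 0 σ} C ∧
      ∀ (f : StrongDual ℝ (HHO.H10 Ω)) (u : HHO.H10 Ω) (U : M.HybridSpace p),
        HHO.IsPoissonSolution f u → HHO.IsDiscreteSolution w E f U →
          HHO.extendedNorm w u (-U)
            ≤ √(1 + C ^ 2) * ⨅ s : M.HybridSpace p, HHO.extendedNorm w u (-s) := by
  have hd0 : 0 < d := by omega
  refine ⟨HHO.existsUnique_discreteSolution hd0 hw E, ?_⟩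
  obtain ⟨C, hC⟩ := HHO.exists_isLeast_smoothing hd0 hΩ hw E
  exact ⟨C, hC, fun f u U hu hU =>
    HHO.extendedNorm_sub_discreteSolution_le hd0 hΩ hw hE hC.1.1 hC.1.2 hu hU⟩
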